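/- For a binary form $F(x,y)$ with rational coefficients and a rational matrix $M=\left(\begin{smallmatrix}s&u\\t&v\end{smallmatrix}\right)$ put $F_M(x,y)=F(sx+uy,\,tx+vy)$. Let $\operatorname{Aut}F$ be the set of all $2\times2$ matrices $M$ with rational entries such that $F_M=F$, and $\operatorname{Aut}|F|$ the set of those such that $F_M=F$ or $F_M=-F$. Let $I$ be the $2\times 2$ identity matrix and let $$\mathbf C_1=\langle I\rangle,\quad \mathbf C_2=\langle -I\rangle,\quad \mathbf C_3=\left\langle\begin{pmatrix}0&1\\-1&-1\end{pmatrix}\right\rangle,\quad \mathbf C_4=\left\langle\begin{pmatrix}0&1\\-1&0\end{pmatrix}\right\rangle,\quad \mathbf C_6=\left\langle\begin{pmatrix}0&-1\\1&1\end{pmatrix}\right\rangle,$$ $$\mathbf D_2=\left\langle\begin{pmatrix}0&1\\1&0\end{pmatrix},-I\right\rangle,\quad \mathbf D_4=\left\langle\begin{pmatrix}0&1\\1&0\end{pmatrix},\begin{pmatrix}0&1\\-1&0\end{pmatrix}\right\rangle,$$ as subgroups of $\operatorname{GL}_2(\mathbb Q)$. For a positive integer $n$ let $\Pi_n(x)$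 be the minimal polynomial of $2\sin(2\pi/n)$ over $\mathbb Q$ and let $\Pi_n(x,y)$ be its homogenization, $\Pi_n(x,y)=y^{\deg\Pi_n}\,\Pi_n(x/y)$. Let $n$ be a positive integer with $n\notin\{1,2,3,4,6,8,12,20\}$, and let $$d=\begin{cases}\varphi(n)&\text{if }\gcd(n,8)<4,\\ \varphi(n)/4&\text{if }\gcd(n,8)=4,\\ \varphi(n)/2&\text{if }\gcd(n,8)>4.\end{cases}$$ Then $\deg\Pi_n=d$ and $d\ge3$, and the following hold. 1. If $n\equiv4\pmod 8$ and $d\ge5$ is odd, then $\operatorname{Aut}\Pi_n=\{I\}\cong\mathbf C_1$ and $\operatorname{Aut}|\Pi_n|=\{\pm I\}\cong\mathbf C_2$. 2. If $n\equiv4\pmod 8$ and $d\ge6$ is even, then $\operatorname{Aut}\Pi_n=\operatorname{Aut}|\Pi_n|=\{\pm I\}\cong\mathbf C_2$. 3. If $n\not\equiv4\pmod 8$ and $n\ne24$, then $\operatorname{Aut}\Pi_n=\left\langle\begin{pmatrix}-1&0\\0&1\end{pmatrix},\begin{pmatrix}1&0\\0&-1\end{pmatrix}\right\rangle\cong\mathbf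 D_2$. 4. (a) If $n\in\{28,36\}$, then $\operatorname{Aut}\Pi_n=\left\langle\begin{pmatrix}-1&1\\-1&0\end{pmatrix}\right\rangle$ is $\operatorname{GL}_2(\mathbb Q)$-conjugate to $\mathbf C_3$, and $\operatorname{Aut}|\Pi_n|=\left\langle\begin{pmatrix}-1&1\\-1&0\end{pmatrix},-I\right\rangle$ is $\operatorname{GL}_2(\mathbb Q)$-conjugate to $\mathbf C_6$. (b) If $n=60$, then $\operatorname{Aut}\Pi_n=\operatorname{Aut}|\Pi_n|=\left\langle\begin{pmatrix}1&2\\-1&-1\end{pmatrix}\right\rangle$ is $\operatorname{GL}_2(\mathbb Q)$-conjugate to $\mathbf C_4$. (c) If $n=24$, then $\operatorname{Aut}\Pi_n=\operatorname{Aut}|\Pi_n|=\left\langle\begin{pmatrix}0&1\\1&0\end{pmatrix},\begin{pmatrix}0&1\\-1&0\end{pmatrix}\right\rangle=\mathbf D_4$; in particular both are $\operatorname{GL}_2(\mathbb Q)$-conjugate to $\mathbf D_4$. -/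

import Mathlib

open Matrix

noncomputable section

/-- The form `F_M(x, y) = F(s x + u y, t x + v y)` for `M = !![s, u; t, v]`: each variable `X i`
is replaced by the linear form `M i 0 * X 0 + M i 1 * X 1`. -/
def formSubst (F : MvPolynomial (Fin 2) ℚ) (M : Matrix (Fin 2) (Fin 2) ℚ) :
    MvPolynomial (Fin 2) ℚ :=
  MvPolynomial.bind₁
    (fun i => MvPolynomial.C (M i 0) * MvPolynomial.X 0 + MvPolynomial.C (M i 1) * MvPolynomial.X 1)
    F

theorem formSubst_one (F : MvPolynomial (Fin 2) ℚ) : formSubst F 1 = F := by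
  have h : (fun i : Fin 2 => MvPolynomial.C ((1 : Matrix (Fin 2) (Fin 2) ℚ) i 0) *
      MvPolynomial.X 0 + MvPolynomial.C ((1 : Matrix (Fin 2) (Fin 2) ℚ) i 1) * MvPolynomial.X 1)
      = MvPolynomial.X := by
    funext i
    fin_cases i <;> simp [Matrix.one_apply]
  rw [formSubst, h, MvPolynomial.bind₁_X_left, AlgHom.id_apply]

theorem formSubst_mul (F : MvPolynomial (Fin 2) ℚ) (M N : Matrix (Fin 2) (Fin 2) ℚ) :
    formSubst F (M * N) = formSubst (formSubst F M) N := by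
  unfold formSubst
  rw [MvPolynomial.bind₁_bind₁]
  congr 2
  funext i
  simp only [map_add, map_mul, MvPolynomial.bind₁_C_right, MvPolynomial.bind₁_X_right,
    Matrix.mul_apply, Fin.sum_univ_two]
  ring

theorem formSubst_neg (F : MvPolynomial (Fin 2) ℚ) (M : Matrix (Fin 2) (Fin 2) ℚ) :
    formSubst (-F) M = -formSubst F M := by
  simp [formSubst]

/-- `Aut F`: all `2 × 2` matrices `M` with rational entries such that `F_M = F`.
Invertibility of `M` is not part of the definition. -/
def formAut (F : MvPolynomial (Fin 2) ℚ) : Submonoid (Matrix (Fin 2) (Fin 2) ℚ) where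
  carrier := {M | formSubst F M = F}
  one_mem' := formSubst_one F
  mul_mem' := by
    intro M N hM hN
    simp only [Set.mem_ofPred_eq] at hM hN ⊢
    rw [formSubst_mul, hM, hN]

/-- `Aut |F|`: all `2 × 2` matrices `M` with rational entries such that `F_M = F` or
`F_M = -F`. -/
def formAbsAut (F : MvPolynomial (Fin 2) ℚ) : Submonoid (Matrix (Fin 2) (Fin 2) ℚ) where
  carrier := {M | formSubst F M = F ∨ formSubst F M = -F}
  one_mem' := Or.inl (formSubst_one F)
  mul_mem' := by
    intro M N hM hN
    simp only [Set.mem_ofPred_eq] at hM hN ⊢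
    rw [formSubst_mul]
    rcases hM with hM | hM <;> rcases hN with hN | hN <;> simp [hM, hN, formSubst_neg]

/-- The subgroup of `GL₂(ℚ)` generated by a set of (invertible) matrices. -/
def glSpan (S : Set (Matrix (Fin 2) (Fin 2) ℚ)) : Subgroup (GL (Fin 2) ℚ) :=
  Subgroup.closure {g | (g : Matrix (Fin 2) (Fin 2) ℚ) ∈ S}

/-- A subgroup of `GL₂(ℚ)`, regarded as a set of matrices closed under multiplication. -/
def glMatrices (G : Subgroup (GL (Fin 2) ℚ)) : Submonoid (Matrix (Fin 2) (Fin 2) ℚ) :=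
  G.toSubmonoid.map (Units.coeHom (Matrix (Fin 2) (Fin 2) ℚ))

/-- `A` is a subgroup of `GL₂(ℚ)` that is `GL₂(ℚ)`-conjugate to `G`. -/
def IsGLConj (A : Submonoid (Matrix (Fin 2) (Fin 2) ℚ)) (G : Subgroup (GL (Fin 2) ℚ)) : Prop :=
  ∃ S : GL (Fin 2) ℚ, A = glMatrices (G.map (MulAut.conj S).toMonoidHom)

/-! The standard representatives of conjugacy classes of finite subgroups of `GL₂(ℚ)`. -/

def groupC1 : Subgroup (GL (Fin 2) ℚ) := glSpan {!![1, 0; 0, 1]}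

def groupC2 : Subgroup (GL (Fin 2) ℚ) := glSpan {!![-1, 0; 0, -1]}

def groupC3 : Subgroup (GL (Fin 2) ℚ) := glSpan {!![0, 1; -1, -1]}

def groupC4 : Subgroup (GL (Fin 2) ℚ) := glSpan {!![0, 1; -1, 0]}

def groupC6 : Subgroup (GL (Fin 2) ℚ) := glSpan {!![0, -1; 1, 1]}

def groupD2 : Subgroup (GL (Fin 2) ℚ) := glSpan {!![0, 1; 1, 0], !![-1, 0; 0, -1]}

def groupD4 : Subgroup (GL (Fin 2) ℚ) := glSpan {!![0, 1; 1, 0], !![0, 1; -1, 0]}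

/-- The minimal polynomial `Π_n(x)` of `2 sin(2π/n)` over `ℚ`. -/
def sinPoly (n : ℕ) : Polynomial ℚ := minpoly ℚ (2 * Real.sin (2 * Real.pi / n))

/-- The binary form `Π_n(x, y)`: the homogenization of `Π_n(x)`, with `x = X 0`, `y = X 1`. -/
def sinForm (n : ℕ) : MvPolynomial (Fin 2) ℚ := (sinPoly n).homogenize (sinPoly n).natDegree

/-- The value `d` of the degree of `Π_n` for `n ∉ {1, 2, 4}`; both divisions are exact there. -/
def sinDegree (n : ℕ) : ℕ :=
  if Nat.gcd n 8 < 4 then Nat.totient n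
  else if Nat.gcd n 8 = 4 then Nat.totient n / 4
  else Nat.totient n / 2

end

/-! A matrix in `formAbsAut (sinForm n)` acts by the Möbius map μ(x) = (sx+u)/(tx+v), and μ sends
the root α = 2 sin(2π/n) to a root β (`moebius_root_of_mem_formAbsAut`). Since sin θ = cos(π/2 - θ),
α = 2 cos(2πk/N) with k prime to N, so β = C_l(α) for some l prime to N, where C_l(2 cos x) = 2
cos(lx) is a rescaled Chebyshev polynomial. The relation μ(α) = C_l(α) has rational coefficients,
hence holds at every conjugate of α; as the C_l commute, μ commutes at α with the Galois action
(`moebius_two_mul_cos_of_conj`). A rational polynomial relation for α of degree less than d is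
trivial, so each conjugate with a simple expression in α restricts μ severely.

If n ≡ 4 mod 8, then α² - 2 or its negative is a conjugate. Commuting with it is a relation of
degree 4, and for d ≥ 5 this forces μ = id (`moebius_eq_id_of_semiconj`). The matrix is then scalar,
and the leading coefficient 1 leaves only ±I.

If n ≢ 4 mod 8, then -α is a conjugate, so μ(x) is cx or c/x (`moebius_of_neg`). The second shape is
excluded by a conjugate γ with γ² = 4 - α² or γ² = α²(4 - α²): writing δ = μ(γ), the equalities αβ =
γδ = c yield a quartic relation for α. It is impossible for d ≥ 5; for n = 5, 10, 16 it would make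
c² equal to 5, 5, 2. Only n = 24 escapes, with c² = 1.

For n = 24, 28, 36, 60 the minimal polynomial is explicit and its roots are written rationally in α.
A matrix is determined up to sign by μ(α), because a non-identity rational Möbius map fixing α would
give a quadratic relation (`eq_or_eq_neg_of_moebius_eq`). It remains to see which roots are reached.
-/

/-! ### Conjugates and degree of 2 cos(2πk/N). -/

theorem Complex.ofReal_two_mul_cos_eq (x : ℝ) :
    ((2 * Real.cos x : ℝ) : ℂ) = Complex.exp (x * Complex.I) + (Complex.exp (x * Complex.I))⁻¹ := by
  rw [← Complex.exp_neg]
  push_cast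
  rw [Complex.cos]
  ring_nf

theorem isPrimitiveRoot_exp_two_pi_mul_div {N : ℕ} (hN : N ≠ 0) {k : ℤ} (hk : IsCoprime k N) :
    IsPrimitiveRoot (Complex.exp (((2 * Real.pi * k / N : ℝ) : ℂ) * Complex.I)) N := by
  have h := (Complex.isPrimitiveRoot_exp N hN).zpow_of_gcd_eq_one k
    (Int.isCoprime_iff_gcd_eq_one.mp hk)
  rw [← Complex.exp_int_mul] at h
  have e : ((2 * Real.pi * k / N : ℝ) : ℂ) * Complex.I =
      k * (2 * Real.pi * Complex.I / N) := by
    push_cast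
    ring
  rwa [e]

theorem isIntegral_two_mul_cos {N : ℕ} (hN : N ≠ 0) {k : ℤ} (hk : IsCoprime k N) :
    IsIntegral ℚ (2 * Real.cos (2 * Real.pi * k / N)) := by
  rw [← isIntegral_algebraMap_iff (algebraMap ℝ ℂ).injective (R := ℚ)]
  have hp := isPrimitiveRoot_exp_two_pi_mul_div hN hk
  rw [Complex.coe_algebraMap, Complex.ofReal_two_mul_cos_eq]
  exact (hp.isIntegral (Nat.pos_of_ne_zero hN)).tower_top.add
    (hp.inv.isIntegral (Nat.pos_of_ne_zero hN)).tower_top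

/-- The real conjugates of `2 cos (2πk/N)` are of the form `2 cos (2πlk/N)`. -/
theorem exists_eq_two_mul_cos_of_aeval_minpoly_eq_zero {N : ℕ} (hN : N ≠ 0) {k : ℤ}
    (hk : IsCoprime k N) {β : ℝ}
    (hβ : Polynomial.aeval β (minpoly ℚ (2 * Real.cos (2 * Real.pi * k / N))) = 0) :
    ∃ l : ℤ, IsCoprime l N ∧ β = 2 * Real.cos (l * (2 * Real.pi * k / N)) := by
  set x : ℝ := 2 * Real.pi * k / N with hx
  set ζ : ℂ := Complex.exp (x * Complex.I) with hζ
  have hp : IsPrimitiveRoot ζ N := isPrimitiveRoot_exp_two_pi_mul_div hN hk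
  have hint : IsIntegral ℚ ζ := (hp.isIntegral (Nat.pos_of_ne_zero hN)).tower_top
  set g : IntermediateField.adjoin ℚ {ζ} := IntermediateField.AdjoinSimple.gen ℚ ζ
  have hg : algebraMap _ ℂ g = ζ := IntermediateField.AdjoinSimple.algebraMap_gen ℚ ζ
  have hα : minpoly ℚ (g + g⁻¹) = minpoly ℚ (2 * Real.cos x) := by
    rw [← minpoly.algebraMap_eq (algebraMap ℝ ℂ).injective (2 * Real.cos x),
      ← minpoly.algebraMap_eq (algebraMap (IntermediateField.adjoin ℚ {ζ}) ℂ).injective,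
      map_add, map_inv₀, hg, Complex.coe_algebraMap, Complex.ofReal_two_mul_cos_eq]
  have : FiniteDimensional ℚ (IntermediateField.adjoin ℚ {ζ}) :=
    IntermediateField.adjoin.finiteDimensional hint
  obtain ⟨φ, hφ⟩ := IntermediateField.exists_algHom_of_splits_of_aeval (F := ℚ) (K := ℂ)
    (E := IntermediateField.adjoin ℚ {ζ}) (x := g + g⁻¹) (y := (β : ℂ))
    (fun s => ⟨Algebra.IsIntegral.isIntegral s, IsAlgClosed.splits _⟩) (by
      rw [hα, ← Complex.coe_algebraMap, Polynomial.aeval_algebraMap_apply, hβ, map_zero])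
  have hgp : IsPrimitiveRoot g N :=
    IsPrimitiveRoot.of_map_of_injective
      (f := algebraMap (IntermediateField.adjoin ℚ {ζ}) ℂ) (by rwa [hg])
      (algebraMap (IntermediateField.adjoin ℚ {ζ}) ℂ).injective
  have hφp : IsPrimitiveRoot (φ g) N := hgp.map_of_injective φ.injective
  have : NeZero N := ⟨hN⟩
  obtain ⟨i, -, hi, hiζ⟩ := hp.isPrimitiveRoot_iff.mp hφp
  refine ⟨i, Nat.isCoprime_iff_coprime.mpr hi, ?_⟩
  apply Complex.ofReal_injective
  rw [← hφ, Complex.ofReal_two_mul_cos_eq, map_add, map_inv₀, ← hiζ, hζ, ← Complex.exp_nat_mul]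
  push_cast
  ring_nf

/-- The field ℚ(ζ) has degree φ(N) over ℚ and is quadratic over ℚ(ζ + ζ⁻¹): ζ is a root of X² - aX +
1, but it is not in the smaller field, which is real, since a real root of unity has order at most
2. -/
theorem natDegree_minpoly_two_mul_cos {N : ℕ} (hN : 2 < N) {k : ℤ} (hk : IsCoprime k N) :
    (minpoly ℚ (2 * Real.cos (2 * Real.pi * k / N))).natDegree = N.totient / 2 := by
  have hN0 : N ≠ 0 := by omega
  set x : ℝ := 2 * Real.pi * k / N with hx
  set ζ : ℂ := Complex.exp (x * Complex.I) with hζ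
  have hp : IsPrimitiveRoot ζ N := isPrimitiveRoot_exp_two_pi_mul_div hN0 hk
  have hint : IsIntegral ℚ ζ := (hp.isIntegral (Nat.pos_of_ne_zero hN0)).tower_top
  have hζ0 : ζ ≠ 0 := Complex.exp_ne_zero _
  set a : ℂ := ((2 * Real.cos x : ℝ) : ℂ) with ha
  have haζ : a = ζ + ζ⁻¹ := Complex.ofReal_two_mul_cos_eq x
  have haint : IsIntegral ℚ a :=
    (isIntegral_algebraMap_iff (algebraMap ℝ ℂ).injective (R := ℚ)).mpr
      (isIntegral_two_mul_cos hN0 hk)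
  rw [← minpoly.algebraMap_eq (algebraMap ℝ ℂ).injective (2 * Real.cos x),
    Complex.coe_algebraMap, ← ha]
  set K := IntermediateField.adjoin ℚ {a} with hK
  have haK : a ∈ K := IntermediateField.mem_adjoin_simple_self ℚ a
  have hKreal : K ≤ (IsScalarTower.toAlgHom ℚ ℝ ℂ).fieldRange := by
    rw [hK, IntermediateField.adjoin_simple_le_iff]
    exact ⟨2 * Real.cos x, rfl⟩
  have hζK : ζ ∉ K := by
    intro h
    obtain ⟨r, hr⟩ := hKreal h
    have hr' : (r : ℂ) = ζ := hr
    have h1 : r ^ N = 1 := by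
      have := hp.pow_eq_one
      rw [← hr'] at this
      exact_mod_cast this
    have h2 : r ^ 2 = 1 := by
      have : |r| = 1 := by
        have := congrArg abs h1
        rw [abs_pow, abs_one] at this
        exact (pow_eq_one_iff_of_nonneg (abs_nonneg r) hN0).mp this
      rw [← sq_abs, this, one_pow]
    have h3 : ζ ^ 2 = 1 := by rw [← hr']; exact_mod_cast h2
    have := Nat.le_of_dvd (by norm_num) (hp.dvd_of_pow_eq_one 2 h3)
    omega
  have hintK : IsIntegral K ζ := hint.tower_top
  have h2 : (minpoly K ζ).natDegree = 2 := by
    apply le_antisymm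
    · have hq : (Polynomial.X ^ 2 - Polynomial.C (⟨a, haK⟩ : K) * Polynomial.X + 1 :
          Polynomial K).natDegree = 2 := by compute_degree!
      rw [← hq]
      apply Polynomial.natDegree_le_of_dvd
      · apply minpoly.dvd
        have key : ζ ^ 2 - a * ζ + 1 = 0 := by
          rw [haζ]
          field_simp
          ring
        have hab : algebraMap K ℂ ⟨a, haK⟩ = a := rfl
        rw [map_add, map_sub, map_mul, map_pow, Polynomial.aeval_X, Polynomial.aeval_C,
          map_one, hab, key]
      · intro h0
        rw [h0] at hq
        simp at hq
    · rw [minpoly.two_le_natDegree_iff hintK]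
      rintro ⟨y, hy⟩
      exact hζK (hy ▸ y.2)
  have e1 : Module.finrank ℚ K = (minpoly ℚ a).natDegree :=
    IntermediateField.adjoin.finrank haint
  have e2 : Module.finrank K (IntermediateField.adjoin K {ζ}) = 2 := by
    rw [IntermediateField.adjoin.finrank hintK, h2]
  have e3 : (IntermediateField.adjoin K {ζ}).restrictScalars ℚ =
      IntermediateField.adjoin ℚ {ζ} := by
    refine (IntermediateField.adjoin_adjoin_left ℚ {a} {ζ}).trans ?_
    apply le_antisymm
    · rw [IntermediateField.adjoin_le_iff]
      have hm := IntermediateField.mem_adjoin_simple_self ℚ ζ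
      rintro y (rfl | rfl)
      · rw [SetLike.mem_coe, haζ]; exact add_mem hm (inv_mem hm)
      · exact hm
    · exact IntermediateField.adjoin.mono _ _ _ (by simp)
  have e4 : Module.finrank ℚ (IntermediateField.adjoin ℚ {ζ}) = N.totient := by
    rw [IntermediateField.adjoin.finrank hint,
      ← Polynomial.cyclotomic_eq_minpoly_rat hp (Nat.pos_of_ne_zero hN0),
      Polynomial.natDegree_cyclotomic]
  have e5 := Module.finrank_mul_finrank ℚ K (IntermediateField.adjoin K {ζ})
  have e6 : Module.finrank ℚ (IntermediateField.adjoin K {ζ}) = N.totient := by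
    rw [← e4, ← e3]; rfl
  rw [e1, e2, e6] at e5
  omega

/-- Both ζ and ζ' are roots of the irreducible cyclotomic polynomial, so some embedding of ℚ(ζ)
takes ζ to ζ', hence ζ + ζ⁻¹ to ζ' + ζ'⁻¹. -/
theorem aeval_two_mul_cos_minpoly_two_mul_cos {N : ℕ} (hN : N ≠ 0) {k k' : ℤ}
    (hk : IsCoprime k N) (hk' : IsCoprime k' N) :
    Polynomial.aeval (2 * Real.cos (2 * Real.pi * k' / N))
      (minpoly ℚ (2 * Real.cos (2 * Real.pi * k / N))) = 0 := by
  set x : ℝ := 2 * Real.pi * k / N with hx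
  set x' : ℝ := 2 * Real.pi * k' / N with hx'
  set ζ : ℂ := Complex.exp (x * Complex.I) with hζ
  set ζ' : ℂ := Complex.exp (x' * Complex.I) with hζ'
  have hp : IsPrimitiveRoot ζ N := isPrimitiveRoot_exp_two_pi_mul_div hN hk
  have hp' : IsPrimitiveRoot ζ' N := isPrimitiveRoot_exp_two_pi_mul_div hN hk'
  have hN' := Nat.pos_of_ne_zero hN
  have hint : IsIntegral ℚ ζ := (hp.isIntegral hN').tower_top
  have : FiniteDimensional ℚ (IntermediateField.adjoin ℚ {ζ}) :=
    IntermediateField.adjoin.finiteDimensional hint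
  set g : IntermediateField.adjoin ℚ {ζ} := IntermediateField.AdjoinSimple.gen ℚ ζ
  have hg : algebraMap _ ℂ g = ζ := IntermediateField.AdjoinSimple.algebraMap_gen ℚ ζ
  have hα : minpoly ℚ (g + g⁻¹) = minpoly ℚ (2 * Real.cos x) := by
    rw [← minpoly.algebraMap_eq (algebraMap ℝ ℂ).injective (2 * Real.cos x),
      ← minpoly.algebraMap_eq (algebraMap (IntermediateField.adjoin ℚ {ζ}) ℂ).injective,
      map_add, map_inv₀, hg, Complex.coe_algebraMap, Complex.ofReal_two_mul_cos_eq]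
  obtain ⟨φ, hφ⟩ := IntermediateField.exists_algHom_of_splits_of_aeval (F := ℚ) (K := ℂ)
    (E := IntermediateField.adjoin ℚ {ζ}) (x := g) (y := ζ')
    (fun s => ⟨Algebra.IsIntegral.isIntegral s, IsAlgClosed.splits _⟩) (by
      rw [← minpoly.algebraMap_eq (algebraMap (IntermediateField.adjoin ℚ {ζ}) ℂ).injective, hg,
        ← Polynomial.cyclotomic_eq_minpoly_rat hp hN',
        Polynomial.cyclotomic_eq_minpoly_rat hp' hN', minpoly.aeval])
  have h0 : φ (Polynomial.aeval (g + g⁻¹) (minpoly ℚ (2 * Real.cos x))) = 0 := by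
    rw [← hα, minpoly.aeval, map_zero]
  rw [← Polynomial.aeval_algHom_apply, map_add, map_inv₀, hφ,
    ← Complex.ofReal_two_mul_cos_eq, ← Complex.coe_algebraMap,
    Polynomial.aeval_algebraMap_apply] at h0
  exact (map_eq_zero_iff _ (algebraMap ℝ ℂ).injective).mp h0

/-! ### Linear independence of low powers of an algebraic number. -/

theorem eq_zero_of_natDegree_lt_minpoly {α : ℝ} {p : Polynomial ℚ}
    (hp : p.natDegree < (minpoly ℚ α).natDegree) (h : Polynomial.aeval α p = 0) : p = 0 := by
  by_contra h0
  exact absurd (Polynomial.natDegree_le_of_dvd (minpoly.dvd ℚ α h) h0) (by omega)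

theorem coeff_eq_zero_of_two_lt_natDegree {α : ℝ} (hα : 2 < (minpoly ℚ α).natDegree)
    {a b c : ℚ} (h : (a : ℝ) + b * α + c * α ^ 2 = 0) : a = 0 ∧ b = 0 ∧ c = 0 := by
  have hp : (Polynomial.C c * Polynomial.X ^ 2 + Polynomial.C b * Polynomial.X +
      Polynomial.C a : Polynomial ℚ) = 0 := by
    apply eq_zero_of_natDegree_lt_minpoly (α := α)
    · refine lt_of_le_of_lt ?_ hα
      compute_degree
    · simp
      linarith
  refine ⟨?_, ?_, ?_⟩
  · simpa using congrArg (Polynomial.coeff · 0) hp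
  · simpa [Polynomial.coeff_X, Polynomial.coeff_C] using congrArg (Polynomial.coeff · 1) hp
  · simpa [Polynomial.coeff_X, Polynomial.coeff_C] using congrArg (Polynomial.coeff · 2) hp

theorem coeff_eq_zero_of_three_lt_natDegree {α : ℝ} (hα : 3 < (minpoly ℚ α).natDegree)
    {a b c d : ℚ} (h : (a : ℝ) + b * α + c * α ^ 2 + d * α ^ 3 = 0) :
    a = 0 ∧ b = 0 ∧ c = 0 ∧ d = 0 := by
  have hp : (Polynomial.C d * Polynomial.X ^ 3 + Polynomial.C c * Polynomial.X ^ 2 +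
      Polynomial.C b * Polynomial.X + Polynomial.C a : Polynomial ℚ) = 0 := by
    apply eq_zero_of_natDegree_lt_minpoly (α := α)
    · refine lt_of_le_of_lt ?_ hα
      compute_degree
    · simp
      linarith
  refine ⟨?_, ?_, ?_, ?_⟩
  · simpa using congrArg (Polynomial.coeff · 0) hp
  · simpa [Polynomial.coeff_X, Polynomial.coeff_C] using congrArg (Polynomial.coeff · 1) hp
  · simpa [Polynomial.coeff_X, Polynomial.coeff_C] using congrArg (Polynomial.coeff · 2) hp
  · simpa [Polynomial.coeff_X, Polynomial.coeff_C] using congrArg (Polynomial.coeff · 3) hp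

theorem coeff_eq_zero_of_four_lt_natDegree {α : ℝ} (hα : 4 < (minpoly ℚ α).natDegree)
    {a b c d e : ℚ} (h : (a : ℝ) + b * α + c * α ^ 2 + d * α ^ 3 + e * α ^ 4 = 0) :
    a = 0 ∧ b = 0 ∧ c = 0 ∧ d = 0 ∧ e = 0 := by
  have hp : (Polynomial.C e * Polynomial.X ^ 4 + Polynomial.C d * Polynomial.X ^ 3 +
      Polynomial.C c * Polynomial.X ^ 2 +
      Polynomial.C b * Polynomial.X + Polynomial.C a : Polynomial ℚ) = 0 := by
    apply eq_zero_of_natDegree_lt_minpoly (α := α)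
    · refine lt_of_le_of_lt ?_ hα
      compute_degree
    · simp
      linarith
  refine ⟨?_, ?_, ?_, ?_, ?_⟩
  · simpa using congrArg (Polynomial.coeff · 0) hp
  · simpa [Polynomial.coeff_X, Polynomial.coeff_C] using congrArg (Polynomial.coeff · 1) hp
  · simpa [Polynomial.coeff_X, Polynomial.coeff_C] using congrArg (Polynomial.coeff · 2) hp
  · simpa [Polynomial.coeff_X, Polynomial.coeff_C] using congrArg (Polynomial.coeff · 3) hp
  · simpa [Polynomial.coeff_X, Polynomial.coeff_C] using congrArg (Polynomial.coeff · 4) hp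

/-! ### Rational Möbius maps compatible with conjugation. -/

theorem aeval_chebyshevC_two_mul_cos (x : ℝ) (l : ℤ) :
    Polynomial.aeval (2 * Real.cos x) (Polynomial.Chebyshev.C ℚ l) = 2 * Real.cos (l * x) := by
  rw [Polynomial.Chebyshev.aeval_C, Polynomial.Chebyshev.C_two_mul_real_cos]

/-- If a rational Möbius map sends `2 cos x` to `2 cos (l x)`, it does the same with every
conjugate of `2 cos x`. -/
theorem moebius_two_mul_cos_of_conj {x y : ℝ} {l : ℤ} {s t u v : ℚ}
    (hy : Polynomial.aeval (2 * Real.cos y) (minpoly ℚ (2 * Real.cos x)) = 0)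
    (h : s * (2 * Real.cos x) + u = 2 * Real.cos (l * x) * (t * (2 * Real.cos x) + v)) :
    s * (2 * Real.cos y) + u = 2 * Real.cos (l * y) * (t * (2 * Real.cos y) + v) := by
  set Q : Polynomial ℚ := Polynomial.C s * Polynomial.X + Polynomial.C u -
    Polynomial.Chebyshev.C ℚ l * (Polynomial.C t * Polynomial.X + Polynomial.C v) with hQ
  have hev : ∀ z : ℝ, Polynomial.aeval (2 * Real.cos z) Q = s * (2 * Real.cos z) + u -
      2 * Real.cos (l * z) * (t * (2 * Real.cos z) + v) := by
    intro z
    rw [hQ, map_sub, map_mul, aeval_chebyshevC_two_mul_cos]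
    simp
  have h0 : Polynomial.aeval (2 * Real.cos x) Q = 0 := by rw [hev, h, sub_self]
  obtain ⟨R, hR⟩ := minpoly.dvd ℚ _ h0
  have := hev y
  rw [hR, map_mul, hy, zero_mul] at this
  linarith

/-- A rational Möbius map commuting at `α` with `x ↦ ε (x ^ 2 - 2)` is the identity, if `α` has
degree at least five. -/
theorem moebius_eq_id_of_semiconj {α β : ℝ} {s t u v ε : ℚ} (hε : ε = 1 ∨ ε = -1)
    (hα : 4 < (minpoly ℚ α).natDegree) (hβ : ∀ q : ℚ, β ≠ q) (hv : (t : ℝ) * α + v ≠ 0)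
    (h₁ : s * α + u = β * (t * α + v))
    (h₂ : s * (ε * (α ^ 2 - 2)) + u = ε * (β ^ 2 - 2) * (t * (ε * (α ^ 2 - 2)) + v)) :
    t = 0 ∧ u = 0 ∧ s = v := by
  -- A map of determinant zero is constant, which would make β rational.
  have hD : s * v - t * u ≠ 0 := by
    intro h0
    have h0' : (s : ℝ) * v - t * u = 0 := by exact_mod_cast h0
    by_cases ht : t = 0
    · have hv' : (v : ℝ) ≠ 0 := by simpa [ht] using hv
      have hs : s = 0 := by
        have : (s : ℝ) * v = 0 := by simpa [ht] using h0'
        exact_mod_cast (mul_eq_zero.mp this).resolve_right hv'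
      refine hβ (u / v) ?_
      push_cast
      rw [eq_div_iff hv']
      simpa [ht, hs, eq_comm] using h₁
    · refine hβ (s / t) ?_
      have ht' : (t : ℝ) ≠ 0 := by exact_mod_cast ht
      push_cast
      rw [eq_div_iff ht']
      apply mul_right_cancel₀ hv
      linear_combination (-(t : ℝ)) * h₁ - h0'
  have hε2 : ε ^ 2 = 1 := by rcases hε with rfl | rfl <;> norm_num
  have hεR : (ε : ℝ) ^ 2 = 1 := by exact_mod_cast hε2
  have key : (s * (ε * (α ^ 2 - 2)) + u) * (t * α + v) ^ 2 =
      ε * ((s * α + u) ^ 2 - 2 * (t * α + v) ^ 2) * (t * (ε * (α ^ 2 - 2)) + v) := by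
    rw [h₁, h₂]; ring
  obtain ⟨c0, c1, c2, c3, c4⟩ := coeff_eq_zero_of_four_lt_natDegree hα
    (a := (u - 2 * ε * s) * v ^ 2 - (u ^ 2 - 2 * v ^ 2) * (ε * v - 2 * t))
    (b := 2 * (u - 2 * ε * s) * t * v - 2 * (s * u - 2 * t * v) * (ε * v - 2 * t))
    (c := s * ε * v ^ 2 + (u - 2 * ε * s) * t ^ 2 - t * (u ^ 2 - 2 * v ^ 2) -
      (s ^ 2 - 2 * t ^ 2) * (ε * v - 2 * t))
    (d := 2 * s * ε * t * v - 2 * t * (s * u - 2 * t * v))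
    (e := s * ε * t ^ 2 - t * (s ^ 2 - 2 * t ^ 2))
    (by
      push_cast
      linear_combination key + ((s * α + u) ^ 2 - 2 * (t * α + v) ^ 2) * t * (α ^ 2 - 2) * hεR)
  -- Otherwise consider the identity at the pole p = -v/t. Its left side vanishes doubly there,
  -- while on the right the first factor does not vanish because the determinant is nonzero. So f(x)
  -- = ε(x² - 2) satisfies f(p) = p (`f0`) and f'(p) = 0 (`f1`). The only critical point of f is 0,
  -- and it is not fixed.
  have ht : t = 0 := by
    by_contra ht
    have f0 : t * (v ^ 2 - 2 * t ^ 2 + ε * v * t) = 0 := by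
      apply (mul_eq_zero.mp ?_).resolve_left (pow_ne_zero 2 hD)
      linear_combination -(c0 * t ^ 4 - c1 * t ^ 3 * v + c2 * t ^ 2 * v ^ 2 - c3 * t * v ^ 3 + c4 * v ^ 4)
    have f0' := (mul_eq_zero.mp f0).resolve_left ht
    have f1 : t * v = 0 := by
      apply (mul_eq_zero.mp ?_).resolve_left (pow_ne_zero 2 hD)
      linear_combination (c1 * t ^ 3 - 2 * c2 * t ^ 2 * v + 3 * c3 * t * v ^ 2 - 4 * c4 * v ^ 3) / 2 -
        s * (s * v - t * u) * t * f0'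
    have hv0 := (mul_eq_zero.mp f1).resolve_left ht
    subst hv0
    apply ht
    have : t ^ 2 = 0 := by linear_combination -f0' / 2
    simpa using this
  subst ht
  have hv' : v ≠ 0 := by rintro rfl; simp at hD
  have hs' : s ≠ 0 := by rintro rfl; simp at hD
  have hε0 : ε ≠ 0 := by rintro rfl; simp at hε2
  have e1 : s = v := by
    have : s * v * ε * (s - v) = 0 := by linear_combination -c2
    simpa [hv', hs', hε0, sub_eq_zero] using this
  have e2 : u = 0 := by
    have : s * v * ε * u = 0 := by linear_combination -c1 / 2
    simpa [hv', hs', hε0] using this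
  exact ⟨rfl, e2, e1⟩

/-- A rational Möbius map commuting at `α` with negation is `x ↦ c x` or `x ↦ c / x`. -/
theorem moebius_of_neg {α β : ℝ} {s t u v : ℚ} (hα : 2 < (minpoly ℚ α).natDegree)
    (hα0 : α ≠ 0) (hβ0 : β ≠ 0) (hv : (t : ℝ) * α + v ≠ 0)
    (h₁ : s * α + u = β * (t * α + v)) (h₂ : s * -α + u = -β * (t * -α + v)) :
    (t = 0 ∧ u = 0) ∨ (s = 0 ∧ v = 0) := by
  have h3 : (s : ℝ) * α = β * v := by linarith
  have h4 : (u : ℝ) = β * t * α := by linarith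
  obtain ⟨hvu, -, hst⟩ := coeff_eq_zero_of_two_lt_natDegree hα
    (a := v * u) (b := 0) (c := -(s * t)) (by
      push_cast
      linear_combination v * h4 - t * α * h3)
  by_cases hv0 : v = 0
  · subst hv0
    simp [hα0] at h3
    exact Or.inr ⟨h3, rfl⟩
  · left
    have hs : s ≠ 0 := by
      rintro rfl
      simp [hβ0, hv0] at h3
    simp [hv0] at hvu
    simp [hs] at hst
    exact ⟨hst, hvu⟩

theorem cos_add_odd_mul_pi_div_two_sq (z : ℝ) {l : ℤ} (hl : Odd l) :
    Real.cos (z + l * (Real.pi / 2)) ^ 2 = Real.sin z ^ 2 := by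
  obtain ⟨r, rfl⟩ := hl
  have : z + ((2 * r + 1 : ℤ) : ℝ) * (Real.pi / 2) = z + r * Real.pi + Real.pi / 2 := by
    push_cast; ring
  rw [this, Real.cos_add_pi_div_two, Real.sin_add_int_mul_pi, neg_sq, mul_pow]
  have h : ((-1 : ℝ) ^ r) ^ 2 = 1 := by
    rw [← sq_abs, abs_zpow, abs_neg, abs_one, _root_.one_zpow, one_pow]
  rw [h, one_mul]

/-! ### Real values of binary forms and constraints on their automorphisms. -/

theorem aeval_formSubst (F : MvPolynomial (Fin 2) ℚ) (M : Matrix (Fin 2) (Fin 2) ℚ) (x y : ℝ) :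
    MvPolynomial.aeval ![x, y] (formSubst F M) =
      MvPolynomial.aeval ![M 0 0 * x + M 0 1 * y, M 1 0 * x + M 1 1 * y] F := by
  rw [formSubst, MvPolynomial.aeval_bind₁]
  congr 2
  funext i
  fin_cases i <;> simp

theorem form_ext {F G : MvPolynomial (Fin 2) ℚ}
    (h : ∀ x y : ℝ, MvPolynomial.aeval ![x, y] F = MvPolynomial.aeval ![x, y] G) : F = G := by
  apply MvPolynomial.map_injective (algebraMap ℚ ℝ) (algebraMap ℚ ℝ).injective
  apply MvPolynomial.funext
  intro p
  have hp : p = ![p 0, p 1] := by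
    funext i
    fin_cases i <;> rfl
  rw [MvPolynomial.eval_map, MvPolynomial.eval_map, hp]
  exact h _ _

theorem aeval_homogenize_natDegree (P : Polynomial ℚ) (x y : ℝ) :
    MvPolynomial.aeval ![x, y] (P.homogenize P.natDegree) =
      ∑ i ∈ Finset.range (P.natDegree + 1), (P.coeff i : ℝ) * x ^ i * y ^ (P.natDegree - i) := by
  rw [Polynomial.homogenize, map_sum, Finset.Nat.sum_antidiagonal_eq_sum_range_succ_mk]
  apply Finset.sum_congr rfl
  intro i _
  rw [MvPolynomial.aeval_monomial, Finsupp.prod_fintype _ _ (by simp)]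
  simp [Fin.prod_univ_two, mul_assoc]

theorem aeval_homogenize_of_ne_zero (P : Polynomial ℚ) (x : ℝ) {y : ℝ} (hy : y ≠ 0) :
    MvPolynomial.aeval ![x, y] (P.homogenize P.natDegree) =
      y ^ P.natDegree * Polynomial.aeval (x / y) P := by
  rw [aeval_homogenize_natDegree, Polynomial.aeval_eq_sum_range, Finset.mul_sum]
  apply Finset.sum_congr rfl
  intro i hi
  have hi' : i ≤ P.natDegree := by simpa [Nat.lt_succ_iff] using hi
  rw [Algebra.smul_def, eq_ratCast, div_pow, pow_sub₀ _ hy hi']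
  field_simp

theorem aeval_homogenize_right_zero {P : Polynomial ℚ} (hP : P.Monic) (x : ℝ) :
    MvPolynomial.aeval ![x, 0] (P.homogenize P.natDegree) = x ^ P.natDegree := by
  rw [aeval_homogenize_natDegree, Finset.sum_range_succ, Finset.sum_eq_zero]
  · simp [hP.coeff_natDegree]
  · intro i hi
    have : P.natDegree - i ≠ 0 := by
      have := Finset.mem_range.mp hi
      omega
    simp [this]

theorem aeval_homogenize_left_zero (P : Polynomial ℚ) (y : ℝ) :
    MvPolynomial.aeval ![0, y] (P.homogenize P.natDegree) =
      P.coeff 0 * y ^ P.natDegree := by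
  rw [aeval_homogenize_natDegree, Finset.sum_eq_single_of_mem 0 (by simp)]
  · simp
  · intro i _ hi
    simp [hi]

theorem aeval_homogenize_smul (P : Polynomial ℚ) (c x y : ℝ) :
    MvPolynomial.aeval ![c * x, c * y] (P.homogenize P.natDegree) =
      c ^ P.natDegree * MvPolynomial.aeval ![x, y] (P.homogenize P.natDegree) := by
  rw [aeval_homogenize_natDegree, aeval_homogenize_natDegree, Finset.mul_sum]
  apply Finset.sum_congr rfl
  intro i hi
  have hi' : i ≤ P.natDegree := by simpa [Nat.lt_succ_iff] using hi
  obtain ⟨j, hj⟩ := Nat.exists_eq_add_of_le hi'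
  rw [hj, Nat.add_sub_cancel_left]
  ring

theorem formAut_le_formAbsAut (F : MvPolynomial (Fin 2) ℚ) : formAut F ≤ formAbsAut F :=
  fun _ hM => Or.inl hM

theorem neg_one_formSubst (P : Polynomial ℚ) :
    formSubst (P.homogenize P.natDegree) (-1) =
      (-1) ^ P.natDegree * P.homogenize P.natDegree := by
  apply form_ext
  intro x y
  rw [aeval_formSubst]
  have := aeval_homogenize_smul P (-1) x y
  simpa using this

theorem neg_one_mem_formAut {P : Polynomial ℚ} (hd : Even P.natDegree) :
    (-1) ∈ formAut (P.homogenize P.natDegree) := by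
  show formSubst _ _ = _
  rw [neg_one_formSubst, hd.neg_one_pow, one_mul]

theorem neg_one_mem_formAbsAut (P : Polynomial ℚ) :
    (-1) ∈ formAbsAut (P.homogenize P.natDegree) := by
  show formSubst _ _ = _ ∨ formSubst _ _ = _
  rw [neg_one_formSubst]
  rcases neg_one_pow_eq_or (MvPolynomial (Fin 2) ℚ) P.natDegree with h | h <;> simp [h]

theorem ne_ratCast_of_two_le_natDegree {α : ℝ} (hα : 2 ≤ (minpoly ℚ α).natDegree) (q : ℚ) :
    α ≠ q := by
  rintro rfl
  have := minpoly.natDegree_eq_one_iff (A := ℚ) (x := (q : ℝ)) |>.mpr ⟨q, by simp⟩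
  omega

/-- The Möbius map of an automorphism of a form permutes the roots of the form. -/
theorem moebius_root_of_mem_formAbsAut {α : ℝ} (hα : 2 ≤ (minpoly ℚ α).natDegree)
    {M : Matrix (Fin 2) (Fin 2) ℚ}
    (hM : M ∈ formAbsAut ((minpoly ℚ α).homogenize (minpoly ℚ α).natDegree)) :
    (M 1 0 : ℝ) * α + M 1 1 ≠ 0 ∧ ∃ β : ℝ, Polynomial.aeval β (minpoly ℚ α) = 0 ∧
      M 0 0 * α + M 0 1 = β * (M 1 0 * α + M 1 1) := by
  set P := minpoly ℚ α with hP
  have hint : IsIntegral ℚ α := by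
    by_contra h
    rw [hP, minpoly.eq_zero h] at hα
    simp at hα
  have hmon : P.Monic := minpoly.monic hint
  have hdet : ∀ x y : ℝ, MvPolynomial.aeval ![x, y] (P.homogenize P.natDegree) = 0 →
      MvPolynomial.aeval ![M 0 0 * x + M 0 1 * y, M 1 0 * x + M 1 1 * y]
        (P.homogenize P.natDegree) = 0 := by
    intro x y h
    rw [← aeval_formSubst]
    rcases hM with hM | hM <;> rw [hM] <;> simp [h]
  have hroot := hdet α 1 (by
    rw [aeval_homogenize_of_ne_zero _ _ one_ne_zero, div_one, hP, minpoly.aeval, mul_zero])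
  have hv : (M 1 0 : ℝ) * α + M 1 1 ≠ 0 := by
    -- Invertibility of M is not given. If the denominator vanishes, F(x, 0) = x^d makes the
    -- numerator vanish too; α being irrational, M = 0, and then F = ±F_M would be zero.
    intro hv
    rw [mul_one, mul_one, hv, aeval_homogenize_right_zero hmon] at hroot
    have hs := pow_eq_zero_iff (by omega : P.natDegree ≠ 0) |>.mp hroot
    have key : ∀ a b : ℚ, (a : ℝ) * α + b = 0 → a = 0 ∧ b = 0 := by
      intro a b hab
      have ha : a = 0 := by
        by_contra ha
        have ha' : (a : ℝ) ≠ 0 := by exact_mod_cast ha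
        apply ne_ratCast_of_two_le_natDegree hα (-b / a)
        push_cast
        rw [eq_div_iff ha']
        linarith
      subst ha
      refine ⟨rfl, ?_⟩
      have : (b : ℝ) = 0 := by simpa using hab
      exact_mod_cast this
    obtain ⟨h1, h2⟩ := key _ _ hv
    obtain ⟨h3, h4⟩ := key _ _ hs
    have h5 : ∀ x y : ℝ, MvPolynomial.aeval ![x, y] (P.homogenize P.natDegree) = 0 := by
      intro x y
      have h6 : MvPolynomial.aeval ![x, y] (formSubst (P.homogenize P.natDegree) M) = 0 := by
        rw [aeval_formSubst, h1, h2, h3, h4]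
        simp only [Rat.cast_zero, zero_mul, add_zero]
        rw [aeval_homogenize_right_zero hmon, zero_pow (by omega)]
      rcases hM with hM | hM <;> rw [hM] at h6 <;> simpa using h6
    have := h5 1 0
    rw [aeval_homogenize_right_zero hmon] at this
    simp at this
  refine ⟨hv, _, ?_, (div_mul_cancel₀ _ hv).symm⟩
  rw [mul_one, mul_one, aeval_homogenize_of_ne_zero _ _ hv] at hroot
  exact (mul_eq_zero.mp hroot).resolve_left (pow_ne_zero _ hv)

/-- Compare values at (1, 0), where a monic form takes the value 1. -/
theorem scalar_pow_of_mem_formAbsAut {P : Polynomial ℚ} (hP : P.Monic)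
    {M : Matrix (Fin 2) (Fin 2) ℚ} (h10 : M 1 0 = 0)
    (hM : M ∈ formAbsAut (P.homogenize P.natDegree)) :
    M 0 0 ^ P.natDegree = 1 ∨ M 0 0 ^ P.natDegree = -1 := by
  have h := aeval_formSubst (P.homogenize P.natDegree) M 1 0
  simp only [h10, mul_one, mul_zero, add_zero, Rat.cast_zero] at h
  rw [aeval_homogenize_right_zero hP] at h
  rcases hM with hM | hM <;> rw [hM] at h
  · left
    rw [aeval_homogenize_right_zero hP, one_pow] at h
    exact_mod_cast h.symm
  · right
    rw [map_neg, aeval_homogenize_right_zero hP, one_pow] at h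
    exact_mod_cast h.symm

theorem scalar_pow_of_mem_formAut {P : Polynomial ℚ} (hP : P.Monic)
    {M : Matrix (Fin 2) (Fin 2) ℚ} (h10 : M 1 0 = 0)
    (hM : M ∈ formAut (P.homogenize P.natDegree)) :
    M 0 0 ^ P.natDegree = 1 := by
  have h := aeval_formSubst (P.homogenize P.natDegree) M 1 0
  simp only [h10, mul_one, mul_zero, add_zero, Rat.cast_zero] at h
  rw [aeval_homogenize_right_zero hP] at h
  rw [show formSubst _ M = _ from hM, aeval_homogenize_right_zero hP, one_pow] at h
  exact_mod_cast h.symm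

theorem lower_pow_of_mem_formAut {P : Polynomial ℚ} (hP : P.coeff 0 ≠ 0)
    {M : Matrix (Fin 2) (Fin 2) ℚ} (h01 : M 0 1 = 0)
    (hM : M ∈ formAut (P.homogenize P.natDegree)) :
    M 1 1 ^ P.natDegree = 1 := by
  have h := aeval_formSubst (P.homogenize P.natDegree) M 0 1
  simp only [h01, mul_one, mul_zero, zero_add, Rat.cast_zero] at h
  rw [aeval_homogenize_left_zero, show formSubst _ M = _ from hM,
    aeval_homogenize_left_zero, one_pow] at h
  have hP' : (P.coeff 0 : ℝ) ≠ 0 := by exact_mod_cast hP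
  have := mul_left_cancel₀ hP' h
  exact_mod_cast this.symm

theorem eq_one_or_eq_neg_one_of_pow {c : ℚ} {d : ℕ} (hd : d ≠ 0) (h : c ^ d = 1 ∨ c ^ d = -1) :
    c = 1 ∨ c = -1 := by
  have h1 : |c| ^ d = 1 := by
    rw [← abs_pow]
    rcases h with h | h <;> simp [h]
  exact eq_or_eq_neg_of_abs_eq ((pow_eq_one_iff_of_nonneg (abs_nonneg c) hd).mp h1)

theorem matrix_eq_of_scalar {M : Matrix (Fin 2) (Fin 2) ℚ} (h10 : M 1 0 = 0) (h01 : M 0 1 = 0)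
    (h : M 0 0 = M 1 1) : M = M 0 0 • 1 := by
  ext i j
  fin_cases i <;> fin_cases j <;> simp [h10, h01, h]

theorem formAbsAut_eq_of_scalar {P : Polynomial ℚ} (hP : P.Monic) (hd : P.natDegree ≠ 0)
    (h : ∀ M ∈ formAbsAut (P.homogenize P.natDegree), M 1 0 = 0 ∧ M 0 1 = 0 ∧ M 0 0 = M 1 1) :
    (formAbsAut (P.homogenize P.natDegree) : Set (Matrix (Fin 2) (Fin 2) ℚ)) = {1, -1} := by
  apply Set.Subset.antisymm
  · intro M hM
    obtain ⟨h10, h01, h00⟩ := h M hM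
    rw [matrix_eq_of_scalar h10 h01 h00]
    rcases eq_one_or_eq_neg_one_of_pow hd (scalar_pow_of_mem_formAbsAut hP h10 hM) with e | e <;>
      simp [e]
  · rintro M (rfl | rfl)
    · exact one_mem _
    · exact neg_one_mem_formAbsAut P

theorem formAut_eq_of_scalar_of_even {P : Polynomial ℚ} (hP : P.Monic) (hd : P.natDegree ≠ 0)
    (he : Even P.natDegree)
    (h : ∀ M ∈ formAbsAut (P.homogenize P.natDegree), M 1 0 = 0 ∧ M 0 1 = 0 ∧ M 0 0 = M 1 1) :
    (formAut (P.homogenize P.natDegree) : Set (Matrix (Fin 2) (Fin 2) ℚ)) = {1, -1} := by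
  apply Set.Subset.antisymm
  · rw [← formAbsAut_eq_of_scalar hP hd h]
    exact formAut_le_formAbsAut _
  · rintro M (rfl | rfl)
    · exact one_mem _
    · exact neg_one_mem_formAut he

theorem formAut_eq_of_scalar_of_odd {P : Polynomial ℚ} (hP : P.Monic)
    (he : Odd P.natDegree)
    (h : ∀ M ∈ formAbsAut (P.homogenize P.natDegree), M 1 0 = 0 ∧ M 0 1 = 0 ∧ M 0 0 = M 1 1) :
    (formAut (P.homogenize P.natDegree) : Set (Matrix (Fin 2) (Fin 2) ℚ)) = {1} := by
  apply Set.Subset.antisymm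
  · intro M hM
    obtain ⟨h10, h01, h00⟩ := h M (formAut_le_formAbsAut _ hM)
    have hpow := scalar_pow_of_mem_formAut hP h10 hM
    rw [matrix_eq_of_scalar h10 h01 h00]
    rcases eq_one_or_eq_neg_one_of_pow he.pos.ne' (Or.inl hpow) with e | e
    · simp [e]
    · rw [e, he.neg_one_pow] at hpow
      norm_num at hpow
  · rintro M rfl
    exact one_mem _

/-! ### Matrix groups -/

/-- Closure under inverses is not built into the submonoid `formAut`. It is what allows a generated
subgroup to be placed inside it by testing generators only, through `glMatrices_glSpan_le`. -/
theorem formAut_of_mul_eq_one {F : MvPolynomial (Fin 2) ℚ} {M N : Matrix (Fin 2) (Fin 2) ℚ}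
    (h : M * N = 1) (hM : M ∈ formAut F) : N ∈ formAut F := by
  show formSubst F N = F
  conv_lhs => rw [← show formSubst F M = F from hM]
  rw [← formSubst_mul, h, formSubst_one]

theorem formAbsAut_of_mul_eq_one {F : MvPolynomial (Fin 2) ℚ} {M N : Matrix (Fin 2) (Fin 2) ℚ}
    (h : M * N = 1) (hM : M ∈ formAbsAut F) : N ∈ formAbsAut F := by
  rcases hM with hM | hM
  · exact Or.inl (formAut_of_mul_eq_one h hM)
  · right
    have h1 : formSubst (formSubst F M) N = F := by rw [← formSubst_mul, h, formSubst_one]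
    rw [hM, formSubst_neg] at h1
    rw [← h1, neg_neg, h1]

theorem glMatrices_glSpan_le {A : Submonoid (Matrix (Fin 2) (Fin 2) ℚ)}
    {S : Set (Matrix (Fin 2) (Fin 2) ℚ)}
    (hA : ∀ M N : Matrix (Fin 2) (Fin 2) ℚ, M * N = 1 → M ∈ A → N ∈ A) (hS : ∀ M ∈ S, M ∈ A) :
    glMatrices (glSpan S) ≤ A := by
  rintro _ ⟨g, hg, rfl⟩
  show (g : Matrix (Fin 2) (Fin 2) ℚ) ∈ A
  induction hg using Subgroup.closure_induction with
  | mem x hx => exact hS _ hx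
  | one => exact one_mem A
  | mul x y _ _ hx hy => exact mul_mem hx hy
  | inv x _ hx => exact hA _ _ (by simp) hx

theorem mem_glMatrices_glSpan {S : Set (Matrix (Fin 2) (Fin 2) ℚ)}
    {M : Matrix (Fin 2) (Fin 2) ℚ} (hM : M ∈ S) (hdet : M.det ≠ 0) :
    M ∈ glMatrices (glSpan S) :=
  ⟨GeneralLinearGroup.mkOfDetNeZero M hdet, Subgroup.subset_closure hM, rfl⟩

theorem glMatrices_closed (G : Subgroup (GL (Fin 2) ℚ)) (M N : Matrix (Fin 2) (Fin 2) ℚ)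
    (h : M * N = 1) (hM : M ∈ glMatrices G) : N ∈ glMatrices G := by
  obtain ⟨g, hg, rfl⟩ := hM
  refine ⟨g⁻¹, G.inv_mem hg, ?_⟩
  exact (left_inv_eq_right_inv (by simp) h : ((g⁻¹ : GL (Fin 2) ℚ) : Matrix (Fin 2) (Fin 2) ℚ) = N)

theorem nonempty_mulEquiv_of_isGLConj {A : Submonoid (Matrix (Fin 2) (Fin 2) ℚ)}
    {G : Subgroup (GL (Fin 2) ℚ)} (h : IsGLConj A G) : Nonempty (A ≃* G) := by
  obtain ⟨S, rfl⟩ := h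
  refine ⟨MulEquiv.symm (MulEquiv.trans
    (G.equivMapOfInjective (MulAut.conj S).toMonoidHom (MulAut.conj S).injective) ?_)⟩
  exact Submonoid.equivMapOfInjective _ _ Units.val_injective

/-- The subgroup generated by `S` is conjugated by `P` to the one generated by `P S P⁻¹`. -/
theorem isGLConj_glSpan {S T : Set (Matrix (Fin 2) (Fin 2) ℚ)} (P Q : Matrix (Fin 2) (Fin 2) ℚ)
    (hPQ : P * Q = 1) (hQP : Q * P = 1) (h : T = (fun A => P * A * Q) '' S) :
    IsGLConj (glMatrices (glSpan T)) (glSpan S) := by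
  refine ⟨⟨P, Q, hPQ, hQP⟩, ?_⟩
  congr 1
  rw [glSpan, glSpan, MonoidHom.map_closure]
  congr 1
  ext g
  set R : GL (Fin 2) ℚ := ⟨P, Q, hPQ, hQP⟩
  simp only [h, Set.mem_image, Set.mem_ofPred_eq]
  constructor
  · rintro ⟨A, hA, hg⟩
    refine ⟨R⁻¹ * g * R, ?_, ?_⟩
    · have : ((R⁻¹ * g * R : GL (Fin 2) ℚ) : Matrix (Fin 2) (Fin 2) ℚ) = A := by
        show Q * g * P = A
        rw [← hg]
        calc Q * (P * A * Q) * P = (Q * P) * A * (Q * P) := by simp only [Matrix.mul_assoc]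
          _ = A := by rw [hQP, Matrix.one_mul, Matrix.mul_one]
      rwa [this]
    · show R * (R⁻¹ * g * R) * R⁻¹ = g
      group
  · rintro ⟨x, hx, rfl⟩
    exact ⟨x, hx, rfl⟩

/-! ### Totient bounds and the size of the degree. -/

/-- By multiplicativity it suffices to treat prime powers. For p ≥ 3 one has p ≤ (p - 1)²; only the
power of 2 costs the factor 2, and of two coprime factors at least one is odd, so the cost is paid
once. The bound reduces statements about small d to finite checks. -/
theorem Nat.le_two_mul_totient_sq {n : ℕ} (hn : 0 < n) :
    (Odd n → n ≤ n.totient ^ 2) ∧ n ≤ 2 * n.totient ^ 2 := by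
  induction n using Nat.recOnPosPrimePosCoprime with
  | prime_pow p k hp hk =>
    obtain ⟨j, rfl⟩ : ∃ j, k = j + 1 := ⟨k - 1, by omega⟩
    rw [Nat.totient_prime_pow_succ hp]
    have hpow : p ^ j ≤ (p ^ j) ^ 2 := Nat.le_self_pow (by norm_num) _
    rcases hp.eq_two_or_odd' with rfl | hodd
    · refine ⟨fun h => absurd h (by simp [pow_succ]), ?_⟩
      rw [pow_succ]
      norm_num
      linarith
    · have hp3 : 3 ≤ p := by
        rcases hodd with ⟨r, rfl⟩
        have := hp.two_le
        omega
      have : p ^ (j + 1) ≤ (p ^ j * (p - 1)) ^ 2 := by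
        obtain ⟨q, rfl⟩ : ∃ q, p = q + 3 := ⟨p - 3, by omega⟩
        rw [pow_succ, mul_pow]
        apply Nat.mul_le_mul hpow
        rw [show q + 3 - 1 = q + 2 by omega]
        nlinarith
      exact ⟨fun _ => this, by omega⟩
  | zero => omega
  | one => simp
  | coprime a b ha hb hab iha ihb =>
    obtain ⟨a1, a2⟩ := iha (by omega)
    obtain ⟨b1, b2⟩ := ihb (by omega)
    rw [Nat.totient_mul hab, mul_pow]
    constructor
    · intro h
      rw [Nat.odd_mul] at h
      exact Nat.mul_le_mul (a1 h.1) (b1 h.2)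
    · rcases Nat.even_or_odd a with hae | hao
      · have hbo : Odd b := by
          by_contra hb'
          rw [Nat.not_odd_iff_even] at hb'
          have := Nat.dvd_gcd hae.two_dvd hb'.two_dvd
          rw [hab] at this
          omega
        calc a * b ≤ (2 * a.totient ^ 2) * b.totient ^ 2 := Nat.mul_le_mul a2 (b1 hbo)
          _ = _ := by ring
      · calc a * b ≤ a.totient ^ 2 * (2 * b.totient ^ 2) := Nat.mul_le_mul (a1 hao) b2
          _ = _ := by ring

theorem Nat.le_of_totient_le {n c : ℕ} (hn : 0 < n) (h : n.totient ≤ c) : n ≤ 2 * c ^ 2 :=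
  (Nat.le_two_mul_totient_sq hn).2.trans (by gcongr)

theorem totient_div_four_le_sinDegree (n : ℕ) : n.totient / 4 ≤ sinDegree n := by
  unfold sinDegree
  split_ifs <;> omega

theorem three_le_sinDegree {n : ℕ} (hpos : 0 < n)
    (hn : n ∉ ({1, 2, 3, 4, 6, 8, 12, 20} : Finset ℕ)) : 3 ≤ sinDegree n := by
  by_contra h
  have h1 := totient_div_four_le_sinDegree n
  have h2 : n ≤ 2 * 11 ^ 2 := Nat.le_of_totient_le hpos (by omega)
  -- A degree below 3 means φ(n) ≤ 11, hence n ≤ 242.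
  have key : ∀ n < 243, 0 < n → n ∉ ({1, 2, 3, 4, 6, 8, 12, 20} : Finset ℕ) →
      3 ≤ sinDegree n := by
    unfold sinDegree
    decide +kernel
  exact h (key n (by omega) hpos hn)

theorem gcd_eight (n : ℕ) : Nat.gcd n 8 = Nat.gcd (n % 8) 8 := by
  rw [Nat.gcd_comm, Nat.gcd_rec]

theorem sinDegree_of_mod_eight_eq_four {n : ℕ} (h : n % 8 = 4) :
    sinDegree n = n.totient / 4 := by
  simp [sinDegree, gcd_eight n, h]

theorem sinDegree_of_mod_eight_eq_zero {n : ℕ} (h : n % 8 = 0) :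
    sinDegree n = n.totient / 2 := by
  simp [sinDegree, gcd_eight n, h]

theorem sinDegree_of_mod_four_ne_zero {n : ℕ} (h : n % 4 ≠ 0) :
    sinDegree n = n.totient := by
  have h8 : n % 8 = 1 ∨ n % 8 = 2 ∨ n % 8 = 3 ∨ n % 8 = 5 ∨ n % 8 = 6 ∨ n % 8 = 7 := by omega
  rcases h8 with h | h | h | h | h | h <;> simp [sinDegree, gcd_eight n, h]

/-- The further exclusions 5, 10, 16, 24 are the n ≢ 4 mod 8 of degree exactly four. -/
theorem five_le_sinDegree {n : ℕ} (hpos : 0 < n)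
    (hn : n ∉ ({1, 2, 3, 4, 6, 8, 12, 20} : Finset ℕ)) (h4 : n % 8 ≠ 4)
    (h : n ∉ ({5, 10, 16, 24} : Finset ℕ)) : 5 ≤ sinDegree n := by
  by_contra hlt
  have h1 : n.totient / 2 ≤ sinDegree n := by
    by_cases h0 : n % 4 = 0
    · rw [sinDegree_of_mod_eight_eq_zero (by omega)]
    · rw [sinDegree_of_mod_four_ne_zero h0]; omega
  have h2 : n ≤ 2 * 9 ^ 2 := Nat.le_of_totient_le hpos (by omega)
  have key : ∀ n < 163, n = 0 ∨ n ∈ ({1, 2, 3, 4, 6, 8, 12, 20} : Finset ℕ) ∨ n % 8 = 4 ∨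
      n ∈ ({5, 10, 16, 24} : Finset ℕ) ∨ 5 ≤ sinDegree n := by
    unfold sinDegree
    decide +kernel
  rcases key n (by omega) with e | e | e | e | e
  exacts [hpos.ne' e, hn e, h4 e, h e, hlt e]

/-! ### Writing 2 sin(2π/n) as 2 cos(2πk/N), with a second useful conjugate. -/

theorem odd_of_isCoprime_of_two_dvd {l : ℤ} {N : ℕ} (h : IsCoprime l N) (hN : 2 ∣ N) : Odd l := by
  by_contra hl
  rw [Int.not_odd_iff_even] at hl
  have := h.isUnit_of_dvd' hl.two_dvd (by exact_mod_cast hN)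
  exact absurd (Int.isUnit_iff.mp this) (by norm_num)

theorem cos_add_odd_mul_pi (z : ℝ) {l : ℤ} (hl : Odd l) :
    Real.cos (z + l * Real.pi) = -Real.cos z := by
  rw [Real.cos_add_int_mul_pi, hl.neg_one_zpow, neg_one_mul]

/-- The squares of k + 2w and k agree modulo 4w. Shifting k by half the modulus negates the cosine,
so this makes -α a conjugate of α. -/
theorem isCoprime_add_half {k : ℤ} {w : ℕ} (h : IsCoprime k ((4 * w : ℕ) : ℤ)) :
    IsCoprime (k + 2 * w) ((4 * w : ℕ) : ℤ) := by
  have h2 : IsCoprime (k * k) ((4 * w : ℕ) : ℤ) := h.mul_left h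
  have h3 := h2.add_mul_left_left (k + w)
  apply IsCoprime.of_mul_left_left (y := k + 2 * w)
  have e : (k + 2 * w) * (k + 2 * w) = k * k + ((4 * w : ℕ) : ℤ) * (k + w) := by
    push_cast
    ring
  rwa [e]

/-- For `n ≡ 4 mod 8`, the number `2 sin (2π/n)` is written as `2 cos (2πk/N)`; the last clause
expresses that `± 2 cos (2x)` is a conjugate of `2 cos x`, compatibly with the Galois action. -/
theorem two_mul_sin_eq_of_mod_eight_eq_four {n : ℕ} (h : n % 8 = 4) (hn : 4 < n) :
    ∃ (N : ℕ) (k k' : ℤ) (ε : ℚ), 2 < N ∧ IsCoprime k N ∧ IsCoprime k' N ∧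
      2 * Real.sin (2 * Real.pi / n) = 2 * Real.cos (2 * Real.pi * k / N) ∧
      N.totient / 2 = sinDegree n ∧ (ε = 1 ∨ ε = -1) ∧
      ∀ l : ℤ, IsCoprime l N → 2 * Real.cos (l * (2 * Real.pi * k' / N)) =
        ε * (2 * Real.cos (2 * (l * (2 * Real.pi * k / N)))) := by
  rw [sinDegree_of_mod_eight_eq_four h]
  rcases (by omega : n % 16 = 4 ∨ n % 16 = 12) with h16 | h16
  · obtain ⟨r, rfl⟩ : ∃ r, n = 4 * (4 * r + 1) := ⟨n / 16, by omega⟩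
    -- Here π/2 - 2π/n = 2πr/(4r+1). The modulus is odd, so k' = 2k is still prime to it.
    refine ⟨4 * r + 1, r, 2 * r, 1, by omega, ⟨-4, 1, by push_cast; ring⟩,
      ⟨-2, 1, by push_cast; ring⟩, ?_, ?_, Or.inl rfl, ?_⟩
    · rw [← Real.cos_pi_div_two_sub]
      congr 2
      push_cast
      field_simp
      ring
    · have hc : Nat.Coprime 4 (4 * r + 1) := by simp
      rw [Nat.totient_mul hc, show Nat.totient 4 = 2 by decide]
      omega
    · intro l _
      push_cast
      rw [one_mul]
      congr 2
      ring
  · obtain ⟨r, rfl⟩ : ∃ r, n = 4 * (4 * r + 3) := ⟨n / 16, by omega⟩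
    have hodd : Odd (4 * r + 3) := ⟨2 * r + 1, by ring⟩
    -- Now the modulus N is even and 2k is not prime to it; k' = 2k + N/2 is, and the half turn (l
    -- being odd) produces the sign -1.
    refine ⟨2 * (4 * r + 3), 2 * r + 1, 8 * r + 5, -1, by omega,
      ⟨4 * r + 1, -r, by push_cast; ring⟩, ⟨-1, 1, by push_cast; ring⟩, ?_, ?_, Or.inr rfl, ?_⟩
    · rw [← Real.cos_pi_div_two_sub]
      congr 2
      push_cast
      field_simp
      ring
    · have hc2 : Nat.Coprime 2 (4 * r + 3) := Nat.coprime_two_left.mpr hodd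
      have hc : Nat.Coprime 4 (4 * r + 3) := Nat.Coprime.pow_left 2 hc2
      rw [Nat.totient_mul hc, Nat.totient_mul hc2, show Nat.totient 4 = 2 by decide,
        show Nat.totient 2 = 1 by decide]
      omega
    · intro l hl
      have hlo : Odd l := odd_of_isCoprime_of_two_dvd hl (by simp)
      have := cos_add_odd_mul_pi (2 * (l * (2 * Real.pi * ((2 * r + 1 : ℤ) : ℝ) /
        ((2 * (4 * r + 3) : ℕ) : ℝ)))) hlo
      have e : (l : ℝ) * (2 * Real.pi * ((8 * r + 5 : ℤ) : ℝ) / ((2 * (4 * r + 3) : ℕ) : ℝ)) =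
          2 * (l * (2 * Real.pi * ((2 * r + 1 : ℤ) : ℝ) /
            ((2 * (4 * r + 3) : ℕ) : ℝ))) + l * Real.pi := by
        push_cast
        field_simp
        ring
      rw [e, this]
      push_cast
      ring

/-- For `n ≢ 4 mod 8`, the number `2 sin (2π/n)` is written as `2 cos (2πk/(4w))`; the last clause
describes a conjugate `γ` of `α = 2 cos x` with `γ² = 4 - α²` or `γ² = α² (4 - α²)`. -/
theorem two_mul_sin_eq_of_mod_eight_ne_four {n : ℕ} (h : n % 8 ≠ 4) (hn : 4 < n) :
    ∃ (w : ℕ) (k k' : ℤ), 0 < w ∧ IsCoprime k ((4 * w : ℕ) : ℤ) ∧ IsCoprime k' ((4 * w : ℕ) : ℤ) ∧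
      2 * Real.sin (2 * Real.pi / n) = 2 * Real.cos (2 * Real.pi * k / (4 * w : ℕ)) ∧
      (4 * w).totient / 2 = sinDegree n ∧
      ((n % 8 = 0 ∧ ∀ l : ℤ, IsCoprime l ((4 * w : ℕ) : ℤ) →
        (2 * Real.cos (l * (2 * Real.pi * k' / (4 * w : ℕ)))) ^ 2 =
          4 - (2 * Real.cos (l * (2 * Real.pi * k / (4 * w : ℕ)))) ^ 2) ∨
       (n % 8 ≠ 0 ∧ ∀ l : ℤ, IsCoprime l ((4 * w : ℕ) : ℤ) →
        (2 * Real.cos (l * (2 * Real.pi * k' / (4 * w : ℕ)))) ^ 2 =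
          (2 * Real.cos (l * (2 * Real.pi * k / (4 * w : ℕ)))) ^ 2 *
          (4 - (2 * Real.cos (l * (2 * Real.pi * k / (4 * w : ℕ)))) ^ 2))) := by
  have hdouble : ∀ (z : ℝ) (l : ℤ), Odd l → (2 * Real.cos (2 * z - l * (Real.pi / 2))) ^ 2 =
      (2 * Real.cos z) ^ 2 * (4 - (2 * Real.cos z) ^ 2) := by
    intro z l hl
    have h1 := cos_add_odd_mul_pi_div_two_sq (2 * z) hl.neg
    push_cast at h1
    rw [neg_mul, ← sub_eq_add_neg] at h1
    rw [mul_pow, h1, Real.sin_two_mul]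
    have := Real.sin_sq_add_cos_sq z
    linear_combination 16 * Real.cos z ^ 2 * this
  have htwo : ∀ w : ℕ, 2 ∣ 4 * w := fun w => ⟨2 * w, by ring⟩
  have hodd4 : ∀ a : ℤ, Odd a → IsCoprime a 4 := by
    rintro a ⟨r, rfl⟩
    have : IsCoprime (2 * r + 1) (2 : ℤ) := ⟨1, -r, by ring⟩
    exact this.pow_right (n := 2)
  have hcopw : ∀ (w : ℕ) (c : ℕ), Odd w → IsCoprime ((w : ℤ) - 2 ^ c * 2) ((4 * w : ℕ) : ℤ) := by
    intro w c hw
    have hwz : Odd (w : ℤ) := by exact_mod_cast hw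
    push_cast
    apply IsCoprime.mul_right
    · apply hodd4
      apply hwz.sub_even
      exact even_two.mul_left _
    · have h1 : IsCoprime (2 : ℤ) w := by
        obtain ⟨r, hr⟩ := hwz
        exact ⟨-r, 1, by rw [hr]; ring⟩
      have h2 : IsCoprime (-(2 ^ c * 2) : ℤ) w := (h1.pow_left.mul_left h1).neg_left
      have e : (w : ℤ) - 2 ^ c * 2 = -(2 ^ c * 2) + w * 1 := by ring
      rw [e]
      exact h2.add_mul_left_left 1
  rcases (by omega : n % 8 = 0 ∨ n % 4 = 2 ∨ n % 2 = 1) with h8 | h4 | h2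
  · obtain ⟨j, rfl⟩ : ∃ j, n = 4 * (2 * j) := ⟨n / 8, by omega⟩
    have hj : 0 < j := by omega
    have hj' : (j : ℝ) ≠ 0 := by positivity
    -- The choice k' = k + w is a quarter turn, exchanging cosine and sine up to sign. The first
    -- Bézout identity is (4j² - 1)(4j² + 1) = 16j⁴ - 1.
    refine ⟨2 * j, 2 * j - 1, 4 * j - 1, by omega,
      ⟨-(2 * j + 1) * (4 * j ^ 2 + 1), 2 * j ^ 3, by push_cast; ring⟩,
      ⟨4 * j - 1, 1 - 2 * j, by push_cast; ring⟩, ?_, ?_, Or.inl ⟨h8, ?_⟩⟩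
    · rw [← Real.cos_pi_div_two_sub]
      congr 2
      push_cast
      field_simp
      ring
    · rw [sinDegree_of_mod_eight_eq_zero h8]
    · intro l hl
      have e : (l : ℝ) * (2 * Real.pi * ((4 * j - 1 : ℤ) : ℝ) / ((4 * (2 * j) : ℕ) : ℝ)) =
          l * (2 * Real.pi * ((2 * j - 1 : ℤ) : ℝ) / ((4 * (2 * j) : ℕ) : ℝ)) +
            l * (Real.pi / 2) := by
        push_cast
        field_simp
        ring
      rw [e, mul_pow, cos_add_odd_mul_pi_div_two_sq _ (odd_of_isCoprime_of_two_dvd hl (htwo _)),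
        Real.sin_sq]
      ring
  · obtain ⟨q, rfl⟩ : ∃ q, n = 2 * q := ⟨n / 2, by omega⟩
    have hq : Odd q := Nat.odd_iff.mpr (by omega)
    have hq' : (q : ℝ) ≠ 0 := by
      have : q ≠ 0 := by omega
      exact_mod_cast this
    -- With w odd, k' = 2k - w is prime to 4w: doubling the angle followed by a quarter turn, as in
    -- `hdouble`. The powers of 2 only fit the form of `hcopw`.
    refine ⟨q, q - 2 ^ 0 * 2, q - 2 ^ 1 * 2, by omega, hcopw q 0 hq, hcopw q 1 hq, ?_, ?_,
      Or.inr ⟨by omega, ?_⟩⟩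
    · rw [← Real.cos_pi_div_two_sub]
      congr 2
      push_cast
      field_simp
      ring
    · have hc2 : Nat.Coprime 2 q := Nat.coprime_two_left.mpr hq
      have hc : Nat.Coprime 4 q := Nat.Coprime.pow_left 2 hc2
      rw [sinDegree_of_mod_four_ne_zero (by omega), Nat.totient_mul hc, Nat.totient_mul hc2,
        show Nat.totient 4 = 2 by decide, show Nat.totient 2 = 1 by decide]
      omega
    · intro l hl
      rw [← hdouble _ l (odd_of_isCoprime_of_two_dvd hl (htwo _))]
      congr 3
      push_cast
      field_simp
      ring
  · have hq : Odd n := Nat.odd_iff.mpr h2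
    have hq' : (n : ℝ) ≠ 0 := by
      have : n ≠ 0 := by omega
      exact_mod_cast this
    refine ⟨n, n - 2 ^ 1 * 2, n - 2 ^ 2 * 2, by omega, hcopw n 1 hq, hcopw n 2 hq, ?_, ?_,
      Or.inr ⟨by omega, ?_⟩⟩
    · rw [← Real.cos_pi_div_two_sub]
      congr 2
      push_cast
      field_simp
      ring
    · have hc2 : Nat.Coprime 2 n := Nat.coprime_two_left.mpr hq
      have hc : Nat.Coprime 4 n := Nat.Coprime.pow_left 2 hc2
      rw [sinDegree_of_mod_four_ne_zero (by omega), Nat.totient_mul hc,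
        show Nat.totient 4 = 2 by decide]
      omega
    · intro l hl
      rw [← hdouble _ l (odd_of_isCoprime_of_two_dvd hl (htwo _))]
      congr 3
      push_cast
      field_simp
      ring

/-! ### The degree of Π_n, and the case n ≡ 4 mod 8 with d ≥ 5. -/

theorem natDegree_sinPoly {n : ℕ} (hpos : 0 < n)
    (hn : n ∉ ({1, 2, 3, 4, 6, 8, 12, 20} : Finset ℕ)) :
    (sinPoly n).natDegree = sinDegree n := by
  have h4 : 4 < n := by
    simp only [Finset.mem_insert, Finset.mem_singleton] at hn
    omega
  by_cases h : n % 8 = 4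
  · obtain ⟨N, k, -, -, hN, hk, -, hα, hd, -⟩ := two_mul_sin_eq_of_mod_eight_eq_four h h4
    rw [sinPoly, hα, natDegree_minpoly_two_mul_cos hN hk, hd]
  · obtain ⟨w, k, -, hw, hk, -, hα, hd, -⟩ := two_mul_sin_eq_of_mod_eight_ne_four h h4
    rw [sinPoly, hα, natDegree_minpoly_two_mul_cos (by omega) hk, hd]

theorem isIntegral_of_natDegree_minpoly_ne_zero {α : ℝ} (h : (minpoly ℚ α).natDegree ≠ 0) :
    IsIntegral ℚ α := by
  by_contra h'
  rw [minpoly.eq_zero h'] at h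
  simp at h

theorem minpoly_eq_of_aeval_minpoly_eq_zero {α β : ℝ} (h : (minpoly ℚ α).natDegree ≠ 0)
    (hβ : Polynomial.aeval β (minpoly ℚ α) = 0) : minpoly ℚ α = minpoly ℚ β :=
  have hint := isIntegral_of_natDegree_minpoly_ne_zero h
  minpoly.eq_of_irreducible_of_monic (minpoly.irreducible hint) hβ (minpoly.monic hint)

theorem scalar_of_mem_formAbsAut_sinForm {n : ℕ} (h : n % 8 = 4) (h4 : 4 < n)
    (hd : 5 ≤ sinDegree n) {M : Matrix (Fin 2) (Fin 2) ℚ} (hM : M ∈ formAbsAut (sinForm n)) :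
    M 1 0 = 0 ∧ M 0 1 = 0 ∧ M 0 0 = M 1 1 := by
  obtain ⟨N, k, k', ε, hN, hk, hk', hα, hdN, hε, hconj⟩ :=
    two_mul_sin_eq_of_mod_eight_eq_four h h4
  rw [sinForm, sinPoly, hα] at hM
  have hdeg := natDegree_minpoly_two_mul_cos hN hk
  rw [hdN] at hdeg
  set x := 2 * Real.pi * k / N with hx
  set y := 2 * Real.pi * k' / N with hy
  obtain ⟨hv, β, hβ, h₁⟩ := moebius_root_of_mem_formAbsAut (by omega) hM
  have hβ2 : ∀ q : ℚ, β ≠ q := by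
    apply ne_ratCast_of_two_le_natDegree
    rw [← minpoly_eq_of_aeval_minpoly_eq_zero (by omega) hβ]
    omega
  obtain ⟨l, hl, rfl⟩ := exists_eq_two_mul_cos_of_aeval_minpoly_eq_zero (by omega) hk hβ
  have h₂ := moebius_two_mul_cos_of_conj (y := y)
    (aeval_two_mul_cos_minpoly_two_mul_cos (by omega) hk hk') h₁
  have e1 := hconj 1 isCoprime_one_left
  rw [Int.cast_one, one_mul, one_mul] at e1
  have e2 := hconj l hl
  rw [e1, e2, Real.cos_two_mul, Real.cos_two_mul] at h₂
  refine moebius_eq_id_of_semiconj hε (by omega) hβ2 hv h₁ ?_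
  linear_combination h₂

/-! ### The case n ≢ 4 mod 8. -/

theorem Rat.sq_ne_prime {p : ℕ} (hp : p.Prime) (q : ℚ) : q ^ 2 ≠ p := by
  intro h
  apply hp.irrational_sqrt
  refine ⟨|q|, ?_⟩
  rw [Rat.cast_abs, ← Real.sqrt_sq_eq_abs]
  congr 1
  exact_mod_cast h

theorem sq_two_mul_sin_two_pi_div (n : ℕ) :
    (2 * Real.sin (2 * Real.pi / n)) ^ 2 = 2 - 2 * Real.cos (4 * Real.pi / n) := by
  have : 4 * Real.pi / n = 2 * (2 * Real.pi / n) := by ring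
  rw [this, Real.cos_two_mul, mul_pow, Real.sin_sq]
  ring

theorem two_mul_sin_quartic_five_or_ten {n : ℕ} (h : n = 5 ∨ n = 10) :
    ((2 * Real.sin (2 * Real.pi / n)) ^ 2) ^ 2 - 5 * (2 * Real.sin (2 * Real.pi / n)) ^ 2 + 5
      = 0 := by
  have h5 : (√5 : ℝ) ^ 2 = 5 := Real.sq_sqrt (by norm_num)
  rw [sq_two_mul_sin_two_pi_div]
  rcases h with rfl | rfl
  · have : 4 * Real.pi / (5 : ℕ) = Real.pi - Real.pi / 5 := by push_cast; ring
    rw [this, Real.cos_pi_sub, Real.cos_pi_div_five]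
    linear_combination h5 / 4
  · have : 4 * Real.pi / (10 : ℕ) = 2 * (Real.pi / 5) := by push_cast; ring
    rw [this, Real.cos_two_mul, Real.cos_pi_div_five]
    linear_combination (3 / 2 - (5 - √5) / 4 + (√5 ^ 2 - 5) / 16) * h5

theorem two_mul_sin_quartic_sixteen :
    ((2 * Real.sin (2 * Real.pi / (16 : ℕ))) ^ 2) ^ 2 -
      4 * (2 * Real.sin (2 * Real.pi / (16 : ℕ))) ^ 2 + 2 = 0 := by
  have h2 : (√2 : ℝ) ^ 2 = 2 := Real.sq_sqrt (by norm_num)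
  rw [sq_two_mul_sin_two_pi_div]
  have : 4 * Real.pi / (16 : ℕ) = Real.pi / 4 := by push_cast; ring
  rw [this, Real.cos_pi_div_four]
  linear_combination h2

theorem two_mul_sin_quartic_twenty_four :
    (2 * Real.sin (2 * Real.pi / (24 : ℕ))) ^ 4 -
      4 * (2 * Real.sin (2 * Real.pi / (24 : ℕ))) ^ 2 + 1 = 0 := by
  have h3 : (√3 : ℝ) ^ 2 = 3 := Real.sq_sqrt (by norm_num)
  have e : ∀ a : ℝ, a ^ 4 = (a ^ 2) ^ 2 := fun a => by ring
  rw [e, sq_two_mul_sin_two_pi_div]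
  have : 4 * Real.pi / (24 : ℕ) = Real.pi / 6 := by push_cast; ring
  rw [this, Real.cos_pi_div_six]
  linear_combination h3

theorem two_mul_sin_pos {n : ℕ} (h4 : 4 < n) : 0 < 2 * Real.sin (2 * Real.pi / n) := by
  have hn : (4 : ℝ) < n := by exact_mod_cast h4
  have : 0 < Real.sin (2 * Real.pi / n) := by
    apply Real.sin_pos_of_pos_of_lt_pi
    · positivity
    · rw [div_lt_iff₀ (by linarith)]
      nlinarith [Real.pi_pos]
  linarith

theorem aeval_neg_minpoly_sin {n : ℕ} (h : n % 8 ≠ 4) (h4 : 4 < n) :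
    Polynomial.aeval (-(2 * Real.sin (2 * Real.pi / n))) (sinPoly n) = 0 := by
  obtain ⟨w, k, -, hw, hk, -, hα, -⟩ := two_mul_sin_eq_of_mod_eight_ne_four h h4
  have := aeval_two_mul_cos_minpoly_two_mul_cos (by omega) hk (isCoprime_add_half hk)
  rw [sinPoly, hα]
  have hw' : (w : ℝ) ≠ 0 := by positivity
  have e : 2 * Real.pi * ((k + 2 * w : ℤ) : ℝ) / ((4 * w : ℕ) : ℝ) =
      2 * Real.pi * k / (4 * w : ℕ) + Real.pi := by
    push_cast
    field_simp
    ring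
  rwa [e, Real.cos_add_pi, mul_neg] at this

/-- For `n ≢ 4 mod 8` with `n ≠ 24`, the automorphisms of `|Π_n|` are diagonal. -/
theorem diagonal_of_mem_formAbsAut_sinForm {n : ℕ} (hpos : 0 < n)
    (hn : n ∉ ({1, 2, 3, 4, 6, 8, 12, 20} : Finset ℕ)) (h : n % 8 ≠ 4) (h24 : n ≠ 24)
    {M : Matrix (Fin 2) (Fin 2) ℚ} (hM : M ∈ formAbsAut (sinForm n)) :
    M 1 0 = 0 ∧ M 0 1 = 0 := by
  have h4 : 4 < n := by
    simp only [Finset.mem_insert, Finset.mem_singleton] at hn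
    omega
  have hdeg := natDegree_sinPoly hpos hn
  have hd3 := three_le_sinDegree hpos hn
  have hneg := aeval_neg_minpoly_sin h h4
  have h510 : n = 5 ∨ n = 10 → _ := two_mul_sin_quartic_five_or_ten (n := n)
  have h16 : n = 16 → ((2 * Real.sin (2 * Real.pi / n)) ^ 2) ^ 2 -
      4 * (2 * Real.sin (2 * Real.pi / n)) ^ 2 + 2 = 0 := by
    rintro rfl
    exact two_mul_sin_quartic_sixteen
  have hα0 := (two_mul_sin_pos h4).ne'
  obtain ⟨w, k, k', hw, hk, hk', hα, hdN, hconj⟩ := two_mul_sin_eq_of_mod_eight_ne_four h h4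
  rw [sinForm] at hM
  rw [sinPoly] at hdeg hM hneg
  rw [hα] at hdeg hM hneg h510 h16 hα0
  set x := 2 * Real.pi * k / (4 * w : ℕ) with hx
  set y := 2 * Real.pi * k' / (4 * w : ℕ) with hy
  set α := 2 * Real.cos x with hαdef
  obtain ⟨hv, β, hβ, h₁⟩ := moebius_root_of_mem_formAbsAut (by omega) hM
  have hβ0 : β ≠ 0 := by
    have := ne_ratCast_of_two_le_natDegree (α := β)
      (by rw [← minpoly_eq_of_aeval_minpoly_eq_zero (by omega) hβ]; omega) 0
    simpa using this
  obtain ⟨l, hl, hβl⟩ := exists_eq_two_mul_cos_of_aeval_minpoly_eq_zero (by omega) hk hβ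
  rw [← hx] at hβl
  have hlo : Odd l := odd_of_isCoprime_of_two_dvd hl ⟨2 * w, by ring⟩
  rw [hβl] at h₁
  have h₂ := moebius_two_mul_cos_of_conj (y := x + Real.pi)
    (by rw [Real.cos_add_pi, mul_neg]; exact hneg) h₁
  rw [mul_add (l : ℝ), cos_add_odd_mul_pi _ hlo, Real.cos_add_pi] at h₂
  have h₃ := moebius_two_mul_cos_of_conj (y := y)
    (aeval_two_mul_cos_minpoly_two_mul_cos (by omega) hk hk') h₁
  rw [← hβl] at h₁
  rcases moebius_of_neg (by omega) hα0 hβ0 hv h₁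
    (by rw [hβl]; linear_combination h₂) with h0 | ⟨hs, hv0⟩
  · exact h0
  -- What remains is μ(x) = c/x with c = u/t, so αβ = c and, at the conjugate γ, γδ = c.
  exfalso
  simp only [hs, hv0, Rat.cast_zero, zero_mul, zero_add, add_zero] at h₁ h₃ hv
  have ht : M 1 0 ≠ 0 := by
    intro h0
    simp [h0] at hv
  have htR : (M 1 0 : ℝ) ≠ 0 := by exact_mod_cast ht
  set u := M 0 1
  set t := M 1 0
  set γ := 2 * Real.cos y
  set δ := 2 * Real.cos (l * y)
  have hu0 : (u : ℝ) ≠ 0 := by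
    rw [h₁]
    exact mul_ne_zero hβ0 (mul_ne_zero htR hα0)
  have hprod : (u : ℝ) ^ 2 = t ^ 2 * γ ^ 2 * δ ^ 2 := by rw [h₃]; ring
  have hbeta : (u : ℝ) ^ 2 = t ^ 2 * α ^ 2 * β ^ 2 := by rw [h₁]; ring
  have hdeg5 : n ∉ ({5, 10, 16, 24} : Finset ℕ) → 5 ≤ sinDegree n :=
    five_le_sinDegree hpos hn h
  simp only [Finset.mem_insert, Finset.mem_singleton, h24, or_false] at hdeg5
  rcases hconj with ⟨h8, hc⟩ | ⟨h8, hc⟩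
  · have hγ := hc 1 isCoprime_one_left
    have hδ := hc l hl
    rw [Int.cast_one, one_mul, one_mul] at hγ
    rw [← hβl] at hδ
    change γ ^ 2 = 4 - α ^ 2 at hγ
    change δ ^ 2 = 4 - β ^ 2 at hδ
    rw [hγ, hδ] at hprod
    -- From α²β² = (4 - α²)(4 - β²) follows α² + β² = 4; multiply by t²α² and eliminate β by u =
    -- tαβ.
    have key : t ^ 2 * α ^ 4 - 4 * t ^ 2 * α ^ 2 + u ^ 2 = 0 := by
      linear_combination hbeta + α ^ 2 / 4 * (hprod - hbeta)
    by_cases hn16 : n = 16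
    · have h16' := h16 hn16
      have : ((u ^ 2 - 2 * t ^ 2 : ℚ) : ℝ) = 0 := by
        push_cast
        linear_combination key - t ^ 2 * h16'
      have e : u ^ 2 - 2 * t ^ 2 = 0 := by exact_mod_cast this
      apply Rat.sq_ne_prime Nat.prime_two (u / t)
      rw [div_pow, div_eq_iff (pow_ne_zero 2 ht)]
      push_cast
      linarith
    · obtain ⟨-, -, -, -, e⟩ := coeff_eq_zero_of_four_lt_natDegree (α := α)
        (a := u ^ 2) (b := 0) (c := -4 * t ^ 2) (d := 0) (e := t ^ 2)
        (by have := hdeg5 (by omega); omega) (by push_cast; linear_combination key)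
      exact pow_ne_zero 2 ht e
  · have hγ := hc 1 isCoprime_one_left
    have hδ := hc l hl
    rw [Int.cast_one, one_mul, one_mul] at hγ
    rw [← hβl] at hδ
    change γ ^ 2 = α ^ 2 * (4 - α ^ 2) at hγ
    change δ ^ 2 = β ^ 2 * (4 - β ^ 2) at hδ
    rw [hγ, hδ] at hprod
    have hone : (4 - α ^ 2) * (4 - β ^ 2) = 1 := by
      apply mul_left_cancel₀ (pow_ne_zero 2 hu0)
      linear_combination (4 - α ^ 2) * (4 - β ^ 2) * hbeta - hprod
    -- Expand (4 - α²)(4 - β²) = 1, multiply by t²α², and eliminate β by u = tαβ.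
    have key : 4 * t ^ 2 * α ^ 4 - (15 * t ^ 2 + u ^ 2) * α ^ 2 + 4 * u ^ 2 = 0 := by
      linear_combination -t ^ 2 * α ^ 2 * hone + (4 - α ^ 2) * hbeta
    by_cases hn5 : n = 5 ∨ n = 10
    · have h5' := h510 hn5
      obtain ⟨-, -, e⟩ := coeff_eq_zero_of_two_lt_natDegree (α := α)
        (a := -4 * (5 * t ^ 2 - u ^ 2)) (b := 0) (c := 5 * t ^ 2 - u ^ 2) (by omega)
        (by push_cast; linear_combination key - 4 * t ^ 2 * h5')
      apply Rat.sq_ne_prime Nat.prime_five (u / t)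
      rw [div_pow, div_eq_iff (pow_ne_zero 2 ht)]
      push_cast
      linarith
    · obtain ⟨-, -, -, -, e⟩ := coeff_eq_zero_of_four_lt_natDegree (α := α)
        (a := 4 * u ^ 2) (b := 0) (c := -(15 * t ^ 2 + u ^ 2)) (d := 0) (e := 4 * t ^ 2)
        (by have := hdeg5 (by omega); omega) (by push_cast; linear_combination key)
      apply pow_ne_zero 2 ht
      linarith

/-- As α and -α share their minimal polynomial, it is even or odd; it is even because its constant
term is nonzero. This is what makes diag(-1, 1) an automorphism. -/
theorem sinPoly_coeff_neg {n : ℕ} (hpos : 0 < n)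
    (hn : n ∉ ({1, 2, 3, 4, 6, 8, 12, 20} : Finset ℕ)) (h : n % 8 ≠ 4) :
    (sinPoly n).coeff 0 ≠ 0 ∧ Even (sinPoly n).natDegree ∧
      ∀ i, (sinPoly n).coeff i * (-1) ^ i = (sinPoly n).coeff i := by
  have h4 : 4 < n := by
    simp only [Finset.mem_insert, Finset.mem_singleton] at hn
    omega
  have hdeg := natDegree_sinPoly hpos hn
  have hd3 := three_le_sinDegree hpos hn
  have hneg := aeval_neg_minpoly_sin h h4
  have hα0 := (two_mul_sin_pos h4).ne'
  have hint : IsIntegral ℚ (2 * Real.sin (2 * Real.pi / n)) :=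
    isIntegral_of_natDegree_minpoly_ne_zero (by rw [← sinPoly]; omega)
  have hmon : (sinPoly n).Monic := minpoly.monic hint
  have h0 : (sinPoly n).coeff 0 ≠ 0 := minpoly.coeff_zero_ne_zero hint hα0
  have hmin : sinPoly n = minpoly ℚ (-(2 * Real.sin (2 * Real.pi / n))) :=
    minpoly_eq_of_aeval_minpoly_eq_zero (by rw [← sinPoly]; omega) hneg
  have hcomp : sinPoly n = (-1) ^ (sinPoly n).natDegree * (sinPoly n).comp (-Polynomial.X) := by
    conv_lhs => rw [hmin, minpoly.neg]
    rfl
  have hco : ∀ i, (sinPoly n).coeff i =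
      (-1) ^ (sinPoly n).natDegree * ((-1) ^ i * (sinPoly n).coeff i) := by
    intro i
    conv_lhs => rw [hcomp]
    have hX : -Polynomial.X = Polynomial.C (-1 : ℚ) * Polynomial.X := by simp
    rw [hX, ← Polynomial.C_1, ← Polynomial.C_neg, ← Polynomial.C_pow, Polynomial.coeff_C_mul,
      Polynomial.comp_C_mul_X_coeff, mul_comm (Polynomial.coeff _ _)]
  have heven : Even (sinPoly n).natDegree := by
    by_contra he
    rw [Nat.not_even_iff_odd] at he
    have := hco 0
    rw [he.neg_one_pow] at this
    apply h0
    linarith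
  refine ⟨h0, heven, fun i => ?_⟩
  have := hco i
  rw [heven.neg_one_pow, one_mul, mul_comm] at this
  exact this.symm

/-! ### The groups C₁, C₂, D₂ as sets of matrices, and the diagonal automorphism group. -/

theorem nonempty_glMatrices_mulEquiv (G : Subgroup (GL (Fin 2) ℚ)) :
    Nonempty (glMatrices G ≃* G) :=
  ⟨(Submonoid.equivMapOfInjective _ _ Units.val_injective).symm⟩

theorem glMatrices_groupC1 : (glMatrices groupC1 : Set (Matrix (Fin 2) (Fin 2) ℚ)) = {1} := by
  apply Set.Subset.antisymm
  · have : glMatrices groupC1 ≤ (⊥ : Submonoid (Matrix (Fin 2) (Fin 2) ℚ)) := by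
      apply glMatrices_glSpan_le
      · intro M N h hM
        rw [Submonoid.mem_bot] at hM ⊢
        rwa [hM, one_mul] at h
      · rintro M rfl
        rw [Submonoid.mem_bot, Matrix.one_fin_two]
    exact this
  · rintro M rfl
    exact one_mem (glMatrices groupC1)

theorem glMatrices_groupC2 :
    (glMatrices groupC2 : Set (Matrix (Fin 2) (Fin 2) ℚ)) = {1, -1} := by
  have hneg : (!![-1, 0; 0, -1] : Matrix (Fin 2) (Fin 2) ℚ) = -1 := by
    rw [Matrix.one_fin_two]
    simp
  let A : Submonoid (Matrix (Fin 2) (Fin 2) ℚ) :=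
    { carrier := {1, -1}
      one_mem' := Or.inl rfl
      mul_mem' := by
        rintro M N (rfl | rfl) (rfl | rfl) <;> simp }
  apply Set.Subset.antisymm
  · have : glMatrices groupC2 ≤ A := by
      apply glMatrices_glSpan_le
      · rintro M N h (rfl | rfl)
        · left
          rwa [one_mul] at h
        · right
          rw [neg_one_mul, neg_eq_iff_eq_neg] at h
          exact h
      · rintro M rfl
        exact Or.inr hneg
    exact this
  · rintro M (rfl | rfl)
    · exact one_mem (glMatrices groupC2)
    · exact mem_glMatrices_glSpan hneg.symm (by simp [Matrix.det_neg])

theorem nonempty_mulEquiv_of_coe_eq {A : Submonoid (Matrix (Fin 2) (Fin 2) ℚ)}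
    {G : Subgroup (GL (Fin 2) ℚ)}
    (h : (A : Set (Matrix (Fin 2) (Fin 2) ℚ)) = glMatrices G) : Nonempty (A ≃* G) := by
  obtain rfl : A = glMatrices G := SetLike.coe_injective h
  exact nonempty_glMatrices_mulEquiv G

theorem neg_one_mem_glMatrices_glSpan_diag :
    (-1 : Matrix (Fin 2) (Fin 2) ℚ) ∈
      glMatrices (glSpan {!![-1, 0; 0, 1], !![1, 0; 0, -1]}) := by
  have := mul_mem (S := Submonoid (Matrix (Fin 2) (Fin 2) ℚ))
    (mem_glMatrices_glSpan (S := {!![-1, 0; 0, 1], !![1, 0; 0, -1]})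
      (Or.inl rfl) (by simp))
    (mem_glMatrices_glSpan (S := {!![-1, 0; 0, 1], !![1, 0; 0, -1]})
      (Or.inr rfl) (by simp))
  convert this using 1
  rw [Matrix.one_fin_two]
  simp

theorem isGLConj_diag_groupD2 :
    IsGLConj (glMatrices (glSpan {!![-1, 0; 0, 1], !![1, 0; 0, -1]})) groupD2 := by
  have e : glMatrices (glSpan {!![-1, 0; 0, 1], !![1, 0; 0, -1]}) =
      glMatrices (glSpan {!![1, 0; 0, -1], !![-1, 0; 0, -1]}) := by
    apply le_antisymm
    · apply glMatrices_glSpan_le (glMatrices_closed _)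
      rintro M (rfl | rfl)
      · have := mul_mem (S := Submonoid (Matrix (Fin 2) (Fin 2) ℚ))
          (mem_glMatrices_glSpan (S := {!![1, 0; 0, -1], !![-1, 0; 0, -1]})
            (Or.inl rfl) (by simp))
          (mem_glMatrices_glSpan (S := {!![1, 0; 0, -1], !![-1, 0; 0, -1]})
            (Or.inr rfl) (by simp))
        simpa using this
      · exact mem_glMatrices_glSpan (Or.inl rfl) (by simp)
    · apply glMatrices_glSpan_le (glMatrices_closed _)
      rintro M (rfl | rfl)
      · exact mem_glMatrices_glSpan (Or.inr rfl) (by simp)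
      · convert neg_one_mem_glMatrices_glSpan_diag using 1
        rw [Matrix.one_fin_two]
        simp
  rw [e]
  -- The columns (1, 1) and (1, -1) are eigenvectors of the swap, so conjugation turns it into
  -- diag(1, -1).
  apply isGLConj_glSpan !![1, 1; 1, -1] !![1 / 2, 1 / 2; 1 / 2, -1 / 2]
  · rw [Matrix.one_fin_two]
    norm_num
  · rw [Matrix.one_fin_two]
    norm_num
  · rw [Set.image_pair]
    norm_num

theorem formAut_sinForm_eq_diag {n : ℕ} (hpos : 0 < n)
    (hn : n ∉ ({1, 2, 3, 4, 6, 8, 12, 20} : Finset ℕ)) (h : n % 8 ≠ 4) (h24 : n ≠ 24) :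
    formAut (sinForm n) = glMatrices (glSpan {!![-1, 0; 0, 1], !![1, 0; 0, -1]}) := by
  obtain ⟨h0, heven, hco⟩ := sinPoly_coeff_neg hpos hn h
  have hd : (sinPoly n).natDegree ≠ 0 := by
    rw [natDegree_sinPoly hpos hn]
    have := three_le_sinDegree hpos hn
    omega
  have hmon : (sinPoly n).Monic := minpoly.monic (isIntegral_of_natDegree_minpoly_ne_zero hd)
  have hD1 : (!![-1, 0; 0, 1] : Matrix (Fin 2) (Fin 2) ℚ) ∈
      glMatrices (glSpan {!![-1, 0; 0, 1], !![1, 0; 0, -1]}) :=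
    mem_glMatrices_glSpan (Or.inl rfl) (by simp)
  have hD2 : (!![1, 0; 0, -1] : Matrix (Fin 2) (Fin 2) ℚ) ∈
      glMatrices (glSpan {!![-1, 0; 0, 1], !![1, 0; 0, -1]}) :=
    mem_glMatrices_glSpan (Or.inr rfl) (by simp)
  apply le_antisymm
  · intro M hM
    obtain ⟨h10, h01⟩ :=
      diagonal_of_mem_formAbsAut_sinForm hpos hn h h24 (formAut_le_formAbsAut _ hM)
    have hs := eq_one_or_eq_neg_one_of_pow hd (Or.inl (scalar_pow_of_mem_formAut hmon h10 hM))
    have hv := eq_one_or_eq_neg_one_of_pow hd (Or.inl (lower_pow_of_mem_formAut h0 h01 hM))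
    rw [Matrix.eta_fin_two M, h10, h01]
    rcases hs with hs | hs <;> rcases hv with hv | hv <;> rw [hs, hv]
    · rw [← Matrix.one_fin_two]
      exact one_mem _
    · exact hD2
    · exact hD1
    · convert neg_one_mem_glMatrices_glSpan_diag using 1
      rw [Matrix.one_fin_two]
      simp
  · have hA : (!![-1, 0; 0, 1] : Matrix (Fin 2) (Fin 2) ℚ) ∈ formAut (sinForm n) := by
      show formSubst _ _ = _
      apply form_ext
      intro x y
      rw [aeval_formSubst, sinForm, aeval_homogenize_natDegree, aeval_homogenize_natDegree]
      apply Finset.sum_congr rfl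
      intro i _
      have : ((sinPoly n).coeff i : ℝ) * (-1) ^ i = (sinPoly n).coeff i := by
        exact_mod_cast hco i
      simp only [of_apply, cons_val', cons_val_zero, cons_val_one, cons_val_fin_one,
        Rat.cast_neg, Rat.cast_one, Rat.cast_zero, zero_mul, add_zero, zero_add, one_mul]
      rw [mul_pow, ← mul_assoc, this]
    apply glMatrices_glSpan_le (fun M N => formAut_of_mul_eq_one)
    rintro M (rfl | rfl)
    · exact hA
    · have := mul_mem hA (neg_one_mem_formAut (P := sinPoly n) heven)
      simpa using this

/-! ### The exceptional forms -/

theorem moebius_scalar_of_fixed {α : ℝ} (hα : 2 < (minpoly ℚ α).natDegree)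
    {M : Matrix (Fin 2) (Fin 2) ℚ}
    (h : M 0 0 * α + M 0 1 = α * (M 1 0 * α + M 1 1)) :
    M 1 0 = 0 ∧ M 0 1 = 0 ∧ M 0 0 = M 1 1 := by
  obtain ⟨h1, h2, h3⟩ := coeff_eq_zero_of_two_lt_natDegree hα
    (a := M 0 1) (b := M 0 0 - M 1 1) (c := -M 1 0) (by push_cast; linear_combination h)
  exact ⟨by linarith, h1, by linarith⟩

/-- Two automorphisms of `|F|` whose Möbius maps agree at a root of `F` are equal up to sign. -/
theorem eq_or_eq_neg_of_moebius_eq {α β : ℝ} (hα : 2 < (minpoly ℚ α).natDegree)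
    {M g h : Matrix (Fin 2) (Fin 2) ℚ}
    (hM : M ∈ formAbsAut ((minpoly ℚ α).homogenize (minpoly ℚ α).natDegree))
    (hg : g ∈ formAbsAut ((minpoly ℚ α).homogenize (minpoly ℚ α).natDegree)) (hgh : g * h = 1)
    (hMβ : M 0 0 * α + M 0 1 = β * (M 1 0 * α + M 1 1))
    (hgβ : g 0 0 * α + g 0 1 = β * (g 1 0 * α + g 1 1)) :
    M = g ∨ M = -g := by
  have hmon : (minpoly ℚ α).Monic :=
    minpoly.monic (isIntegral_of_natDegree_minpoly_ne_zero (by omega))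
  have hhg : h * g = 1 := mul_eq_one_comm.mp hgh
  have hN : h * M ∈ formAbsAut ((minpoly ℚ α).homogenize (minpoly ℚ α).natDegree) :=
    mul_mem (formAbsAut_of_mul_eq_one hgh hg) hM
  have hent : ∀ i j, h i 0 * g 0 j + h i 1 * g 1 j = (1 : Matrix (Fin 2) (Fin 2) ℚ) i j := by
    intro i j
    rw [← hhg, Matrix.mul_apply, Fin.sum_univ_two]
  have e00 : (h 0 0 : ℝ) * g 0 0 + h 0 1 * g 1 0 = 1 := by exact_mod_cast hent 0 0
  have e01 : (h 0 0 : ℝ) * g 0 1 + h 0 1 * g 1 1 = 0 := by exact_mod_cast hent 0 1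
  have e10 : (h 1 0 : ℝ) * g 0 0 + h 1 1 * g 1 0 = 0 := by exact_mod_cast hent 1 0
  have e11 : (h 1 0 : ℝ) * g 0 1 + h 1 1 * g 1 1 = 1 := by exact_mod_cast hent 1 1
  set c := (g 1 0 : ℝ) * α + g 1 1 with hc
  have f0 : (h 0 0 * β + h 0 1) * c = α := by
    linear_combination α * e00 + e01 - h 0 0 * hgβ + h 0 1 * hc
  have f1 : (h 1 0 * β + h 1 1) * c = 1 := by
    linear_combination α * e10 + e11 - h 1 0 * hgβ + h 1 1 * hc
  -- The inverse h takes β back to α, so hM fixes α and is therefore scalar.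
  have hfix : (h 0 0 * β + h 0 1) = α * (h 1 0 * β + h 1 1) := by
    have hc0 : c ≠ 0 := by
      rintro hc0
      rw [hc0, mul_zero] at f1
      exact zero_ne_one f1
    apply mul_right_cancel₀ hc0
    rw [f0, mul_assoc, f1, mul_one]
  obtain ⟨s10, s01, s00⟩ := moebius_scalar_of_fixed hα (M := h * M) (by
    simp only [Matrix.mul_apply, Fin.sum_univ_two]
    push_cast
    linear_combination (h 0 0 - α * h 1 0) * hMβ + (M 1 0 * α + M 1 1) * hfix)
  have hMg : M = g * (h * M) := by rw [← mul_assoc, hgh, one_mul]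
  have hscal := matrix_eq_of_scalar s10 s01 s00
  rcases eq_one_or_eq_neg_one_of_pow (by omega) (scalar_pow_of_mem_formAbsAut hmon s10 hN)
    with e | e
  · left
    rw [hMg, hscal, e, one_smul, mul_one]
  · right
    rw [hMg, hscal, e, neg_one_smul, mul_neg, mul_one]

/-- In odd degree -I negates the form. -/
theorem not_mem_formAut_neg {α : ℝ} (hα : Odd (minpoly ℚ α).natDegree)
    {g : Matrix (Fin 2) (Fin 2) ℚ}
    (hg : g ∈ formAut ((minpoly ℚ α).homogenize (minpoly ℚ α).natDegree)) :
    -g ∉ formAut ((minpoly ℚ α).homogenize (minpoly ℚ α).natDegree) := by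
  intro h
  have h1 : formSubst ((minpoly ℚ α).homogenize (minpoly ℚ α).natDegree) (-g) = _ := h
  have h2 : formSubst ((minpoly ℚ α).homogenize (minpoly ℚ α).natDegree) g = _ := hg
  rw [← neg_one_mul, formSubst_mul, neg_one_formSubst, hα.neg_one_pow, neg_one_mul, formSubst_neg,
    h2, neg_eq_self, Polynomial.homogenize_eq_zero_iff le_rfl] at h1
  rw [h1] at hα
  simp at hα

theorem minpoly_eq_of_natDegree_eq {α : ℝ} {Q : Polynomial ℚ} (hQ : Q.Monic)
    (h : Polynomial.aeval α Q = 0) (hd : (minpoly ℚ α).natDegree = Q.natDegree) :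
    minpoly ℚ α = Q := by
  have hint : IsIntegral ℚ α := ⟨Q, hQ, h⟩
  exact (Polynomial.eq_of_monic_of_dvd_of_natDegree_le (minpoly.monic hint) hQ
    (minpoly.dvd ℚ α h) hd.ge).symm

theorem aeval_homogenize_cubic {P : Polynomial ℚ} {a b c : ℚ}
    (hP : P = Polynomial.X ^ 3 + Polynomial.C a * Polynomial.X ^ 2 +
      Polynomial.C b * Polynomial.X + Polynomial.C c) (x y : ℝ) :
    MvPolynomial.aeval ![x, y] (P.homogenize P.natDegree) =
      x ^ 3 + a * x ^ 2 * y + b * x * y ^ 2 + c * y ^ 3 := by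
  have hd : P.natDegree = 3 := by
    rw [hP]
    compute_degree!
  rw [aeval_homogenize_natDegree, hd]
  simp [Finset.sum_range_succ, hP, Polynomial.coeff_X, Polynomial.coeff_C, Polynomial.coeff_X_pow]
  ring

theorem aeval_homogenize_quartic {P : Polynomial ℚ} {a b c d : ℚ}
    (hP : P = Polynomial.X ^ 4 + Polynomial.C a * Polynomial.X ^ 3 +
      Polynomial.C b * Polynomial.X ^ 2 + Polynomial.C c * Polynomial.X + Polynomial.C d)
    (x y : ℝ) :
    MvPolynomial.aeval ![x, y] (P.homogenize P.natDegree) =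
      x ^ 4 + a * x ^ 3 * y + b * x ^ 2 * y ^ 2 + c * x * y ^ 3 + d * y ^ 4 := by
  have hd : P.natDegree = 4 := by
    rw [hP]
    compute_degree!
  rw [aeval_homogenize_natDegree, hd]
  simp [Finset.sum_range_succ, hP, Polynomial.coeff_X, Polynomial.coeff_C, Polynomial.coeff_X_pow]
  ring

theorem neg_one_eq_fin_two : (-1 : Matrix (Fin 2) (Fin 2) ℚ) = !![-1, 0; 0, -1] := by
  rw [Matrix.one_fin_two]
  simp

/-- Automorphisms of the cubic forms `x³ + a x²y - (a + 3) xy² + y³`. -/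
theorem formAut_simplest_cubic {α : ℝ} {a : ℚ}
    (hP : minpoly ℚ α = Polynomial.X ^ 3 + Polynomial.C a * Polynomial.X ^ 2 +
      Polynomial.C (-(a + 3)) * Polynomial.X + Polynomial.C 1) :
    formAut ((minpoly ℚ α).homogenize (minpoly ℚ α).natDegree) =
      glMatrices (glSpan {!![-1, 1; -1, 0]}) ∧
    formAbsAut ((minpoly ℚ α).homogenize (minpoly ℚ α).natDegree) =
      glMatrices (glSpan {!![-1, 1; -1, 0], !![-1, 0; 0, -1]}) := by
  have hd : (minpoly ℚ α).natDegree = 3 := by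
    rw [hP]
    compute_degree!
  set F := (minpoly ℚ α).homogenize (minpoly ℚ α).natDegree with hF
  have hα : α ^ 3 + a * α ^ 2 - (a + 3) * α + 1 = 0 := by
    have := minpoly.aeval ℚ α
    rw [hP] at this
    simp at this
    linear_combination this
  have hB : (!![-1, 1; -1, 0] : Matrix (Fin 2) (Fin 2) ℚ) ∈ formAut F := by
    show formSubst _ _ = _
    apply form_ext
    intro x y
    rw [aeval_formSubst, hF, aeval_homogenize_cubic hP, aeval_homogenize_cubic hP]
    simp
    ring
  have hB2 : (!![-1, 1; -1, 0] : Matrix (Fin 2) (Fin 2) ℚ) * !![-1, 1; -1, 0] =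
      !![0, -1; 1, -1] := by norm_num
  have hB3 : (!![-1, 1; -1, 0] : Matrix (Fin 2) (Fin 2) ℚ) * !![0, -1; 1, -1] = 1 := by
    rw [Matrix.one_fin_two]
    norm_num
  have hB3' : (!![0, -1; 1, -1] : Matrix (Fin 2) (Fin 2) ℚ) * !![-1, 1; -1, 0] = 1 :=
    mul_eq_one_comm.mp hB3
  have hBB : (!![0, -1; 1, -1] : Matrix (Fin 2) (Fin 2) ℚ) ∈ formAut F := by
    rw [← hB2]
    exact mul_mem hB hB
  have hcases : ∀ M ∈ formAbsAut F, ∃ g ∈ formAut F,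
      g ∈ glMatrices (glSpan {!![-1, 1; -1, 0]}) ∧ (M = g ∨ M = -g) := by
    intro M hM
    obtain ⟨-, β, hβ, h₁⟩ := moebius_root_of_mem_formAbsAut (by omega) hM
    rw [hP] at hβ
    simp at hβ
    have hBs : !![-1, 1; -1, 0] ∈ glMatrices (glSpan {!![-1, 1; -1, 0]}) :=
      mem_glMatrices_glSpan rfl (by simp)
    -- The roots are α, 1 - 1/α and 1/(1 - α), the orbit of α under the order-three map. Modulo P(α)
    -- the product is α(1 - α)P(β).
    have hprod : (β - α) * (α * β - α + 1) * (β * (1 - α) - 1) = 0 := by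
      linear_combination α * (1 - α) * hβ - (β - β ^ 2) * hα
    rcases mul_eq_zero.mp hprod with h12 | h3
    · rcases mul_eq_zero.mp h12 with h1 | h2
      · refine ⟨1, one_mem _, one_mem _, eq_or_eq_neg_of_moebius_eq (by omega) hM (one_mem _)
          (one_mul 1) h₁ ?_⟩
        simp
        linarith
      · refine ⟨_, hB, hBs, eq_or_eq_neg_of_moebius_eq (by omega) hM
          (formAut_le_formAbsAut _ hB) hB3 h₁ ?_⟩
        simp
        linarith
    · refine ⟨_, hBB, hB2 ▸ mul_mem hBs hBs, eq_or_eq_neg_of_moebius_eq (by omega) hM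
        (formAut_le_formAbsAut _ hBB) hB3' h₁ ?_⟩
      simp
      linarith
  have hodd : Odd (minpoly ℚ α).natDegree := by rw [hd]; decide
  constructor
  · apply le_antisymm
    · intro M hM
      obtain ⟨g, hg, hgs, rfl | rfl⟩ := hcases M (formAut_le_formAbsAut _ hM)
      · exact hgs
      · exact absurd hM (not_mem_formAut_neg hodd hg)
    · apply glMatrices_glSpan_le (fun M N => formAut_of_mul_eq_one)
      rintro M rfl
      exact hB
  · have hneg : (-1 : Matrix (Fin 2) (Fin 2) ℚ) ∈
        glMatrices (glSpan {!![-1, 1; -1, 0], !![-1, 0; 0, -1]}) := by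
      rw [neg_one_eq_fin_two]
      exact mem_glMatrices_glSpan (Or.inr rfl) (by simp)
    have hle : glMatrices (glSpan {!![-1, 1; -1, 0]}) ≤
        glMatrices (glSpan {!![-1, 1; -1, 0], !![-1, 0; 0, -1]}) := by
      apply glMatrices_glSpan_le (glMatrices_closed _)
      rintro M rfl
      exact mem_glMatrices_glSpan (Or.inl rfl) (by simp)
    apply le_antisymm
    · intro M hM
      obtain ⟨g, hg, hgs, rfl | rfl⟩ := hcases M hM
      · exact hle hgs
      · exact neg_one_mul g ▸ mul_mem hneg (hle hgs)
    · apply glMatrices_glSpan_le (fun M N => formAbsAut_of_mul_eq_one)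
      rintro M (rfl | rfl)
      · exact Or.inl hB
      · rw [← neg_one_eq_fin_two]
        exact neg_one_mem_formAbsAut _

theorem isGLConj_groupC3 : IsGLConj (glMatrices (glSpan {!![-1, 1; -1, 0]})) groupC3 := by
  apply isGLConj_glSpan !![1, 1; 0, 1] !![1, -1; 0, 1]
  · rw [Matrix.one_fin_two]
    norm_num
  · rw [Matrix.one_fin_two]
    norm_num
  · rw [Set.image_singleton]
    norm_num

theorem isGLConj_groupC6 :
    IsGLConj (glMatrices (glSpan {!![-1, 1; -1, 0], !![-1, 0; 0, -1]})) groupC6 := by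
  have e : glMatrices (glSpan {!![-1, 1; -1, 0], !![-1, 0; 0, -1]}) =
      glMatrices (glSpan {!![1, -1; 1, 0]}) := by
    apply le_antisymm
    · have hg : !![1, -1; 1, 0] ∈ glMatrices (glSpan {!![1, -1; 1, 0]}) :=
        mem_glMatrices_glSpan rfl (by simp)
      have h3 := pow_mem hg 3
      have h4 := pow_mem hg 4
      apply glMatrices_glSpan_le (glMatrices_closed _)
      rintro M (rfl | rfl)
      · convert h4 using 1
        simp [pow_succ]
      · convert h3 using 1
        simp [pow_succ]
    · apply glMatrices_glSpan_le (glMatrices_closed _)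
      rintro M rfl
      have := mul_mem (S := Submonoid (Matrix (Fin 2) (Fin 2) ℚ))
        (mem_glMatrices_glSpan (S := {!![-1, 1; -1, 0], !![-1, 0; 0, -1]})
          (Or.inl rfl) (by simp))
        (mem_glMatrices_glSpan (S := {!![-1, 1; -1, 0], !![-1, 0; 0, -1]})
          (Or.inr rfl) (by simp))
      simpa using this
  rw [e]
  apply isGLConj_glSpan !![1, 1; 0, 1] !![1, -1; 0, 1]
  · rw [Matrix.one_fin_two]
    norm_num
  · rw [Matrix.one_fin_two]
    norm_num
  · rw [Set.image_singleton]
    norm_num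

theorem isGLConj_groupC4 : IsGLConj (glMatrices (glSpan {!![1, 2; -1, -1]})) groupC4 := by
  apply isGLConj_glSpan !![1, -1; 0, 1] !![1, 1; 0, 1]
  · rw [Matrix.one_fin_two]
    norm_num
  · rw [Matrix.one_fin_two]
    norm_num
  · rw [Set.image_singleton]
    norm_num

theorem isGLConj_groupD4 :
    IsGLConj (glMatrices (glSpan {!![0, 1; 1, 0], !![0, 1; -1, 0]})) groupD4 := by
  apply isGLConj_glSpan 1 1 (one_mul 1) (one_mul 1)
  simp

/-! ### Explicit minimal polynomials for n = 24, 28, 36, 60. -/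

theorem two_mul_sin_cubic_twenty_eight :
    (2 * Real.sin (2 * Real.pi / (28 : ℕ))) ^ 3 - (2 * Real.sin (2 * Real.pi / (28 : ℕ))) ^ 2 -
      2 * (2 * Real.sin (2 * Real.pi / (28 : ℕ))) + 1 = 0 := by
  set x := 2 * Real.pi / (28 : ℕ) with hx
  have hc : Real.cos x ≠ 0 := by
    apply (Real.cos_pos_of_mem_Ioo ⟨?_, ?_⟩).ne'
    · rw [hx]
      push_cast
      linarith [Real.pi_pos]
    · rw [hx]
      push_cast
      linarith [Real.pi_pos]
  -- Here x = π/14, so 4x + 3x = π/2; a factor cos x then cancels from both sides.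
  have h : Real.sin (2 * (2 * x)) = Real.cos (3 * x) := by
    rw [← Real.cos_pi_div_two_sub]
    congr 1
    rw [hx]
    push_cast
    ring
  rw [Real.sin_two_mul, Real.cos_two_mul, Real.sin_two_mul, Real.cos_three_mul] at h
  have h1 := Real.sin_sq_add_cos_sq x
  have h2 : 4 * Real.cos x ^ 2 - 3 - 4 * Real.sin x * (2 * Real.cos x ^ 2 - 1) = 0 := by
    apply (mul_eq_zero.mp ?_).resolve_left hc
    linear_combination -h
  linear_combination h2 + (8 * Real.sin x - 4) * h1

theorem two_mul_sin_cubic_thirty_six :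
    (2 * Real.sin (2 * Real.pi / (36 : ℕ))) ^ 3 -
      3 * (2 * Real.sin (2 * Real.pi / (36 : ℕ))) + 1 = 0 := by
  have h := Real.sin_three_mul (2 * Real.pi / (36 : ℕ))
  have e : 3 * (2 * Real.pi / (36 : ℕ)) = Real.pi / 6 := by push_cast; ring
  rw [e, Real.sin_pi_div_six] at h
  linear_combination 2 * h

/-- With x = π/30, the equation sin 5x = 1/2 is a quintic in 2 sin x having 1 as a root; the
remaining quartic is the minimal polynomial. -/
theorem two_mul_sin_quintic_sixty :
    (2 * Real.sin (2 * Real.pi / (60 : ℕ)) - 1) * ((2 * Real.sin (2 * Real.pi / (60 : ℕ))) ^ 4 +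
      (2 * Real.sin (2 * Real.pi / (60 : ℕ))) ^ 3 -
      4 * (2 * Real.sin (2 * Real.pi / (60 : ℕ))) ^ 2 -
      4 * (2 * Real.sin (2 * Real.pi / (60 : ℕ))) + 1) = 0 := by
  set x := 2 * Real.pi / (60 : ℕ) with hx
  have h : Real.sin (3 * x + 2 * x) = 1 / 2 := by
    rw [← Real.sin_pi_div_six]
    congr 1
    rw [hx]
    push_cast
    ring
  rw [Real.sin_add, Real.sin_three_mul, Real.cos_three_mul, Real.sin_two_mul, Real.cos_two_mul] at h
  have h1 := Real.sin_sq_add_cos_sq x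
  have h2 : Real.cos x ^ 2 = 1 - Real.sin x ^ 2 := by linarith
  have h3 : Real.cos x ^ 4 = (1 - Real.sin x ^ 2) ^ 2 := by rw [← h2]; ring
  linear_combination 2 * h - (12 * Real.sin x - 16 * Real.sin x ^ 3 - 12 * Real.sin x) * h2 -
    16 * Real.sin x * h3

theorem sinDegree_twenty_eight : sinDegree 28 = 3 := by
  rw [sinDegree_of_mod_eight_eq_four rfl, show Nat.totient 28 = 12 by decide]

theorem sinDegree_thirty_six : sinDegree 36 = 3 := by
  rw [sinDegree_of_mod_eight_eq_four rfl, show Nat.totient 36 = 12 by decide]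

theorem sinDegree_sixty : sinDegree 60 = 4 := by
  rw [sinDegree_of_mod_eight_eq_four rfl, show Nat.totient 60 = 16 by decide]

theorem sinDegree_twenty_four : sinDegree 24 = 4 := by
  rw [sinDegree_of_mod_eight_eq_zero rfl, show Nat.totient 24 = 8 by decide]

theorem sinPoly_twenty_eight :
    sinPoly 28 = Polynomial.X ^ 3 + Polynomial.C (-1) * Polynomial.X ^ 2 +
      Polynomial.C (-(-1 + 3)) * Polynomial.X + Polynomial.C 1 := by
  apply minpoly_eq_of_natDegree_eq
  · monicity!
  · simp
    linear_combination two_mul_sin_cubic_twenty_eight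
  · rw [← sinPoly, natDegree_sinPoly (by norm_num) (by decide), sinDegree_twenty_eight]
    symm
    compute_degree!

theorem sinPoly_thirty_six :
    sinPoly 36 = Polynomial.X ^ 3 + Polynomial.C 0 * Polynomial.X ^ 2 +
      Polynomial.C (-(0 + 3)) * Polynomial.X + Polynomial.C 1 := by
  apply minpoly_eq_of_natDegree_eq
  · monicity!
  · simp
    linear_combination two_mul_sin_cubic_thirty_six
  · rw [← sinPoly, natDegree_sinPoly (by norm_num) (by decide), sinDegree_thirty_six]
    symm
    compute_degree!

theorem sinPoly_twenty_four :
    sinPoly 24 = Polynomial.X ^ 4 + Polynomial.C 0 * Polynomial.X ^ 3 +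
      Polynomial.C (-4) * Polynomial.X ^ 2 + Polynomial.C 0 * Polynomial.X +
      Polynomial.C 1 := by
  apply minpoly_eq_of_natDegree_eq
  · monicity!
  · simp
    linear_combination two_mul_sin_quartic_twenty_four
  · rw [← sinPoly, natDegree_sinPoly (by norm_num) (by decide), sinDegree_twenty_four]
    symm
    compute_degree!

theorem sinPoly_sixty :
    sinPoly 60 = Polynomial.X ^ 4 + Polynomial.C 1 * Polynomial.X ^ 3 +
      Polynomial.C (-4) * Polynomial.X ^ 2 + Polynomial.C (-4) * Polynomial.X +
      Polynomial.C 1 := by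
  have hd : (sinPoly 60).natDegree = 4 := by
    rw [natDegree_sinPoly (by norm_num) (by decide), sinDegree_sixty]
  apply minpoly_eq_of_natDegree_eq
  · monicity!
  · have hne := ne_ratCast_of_two_le_natDegree
      (α := 2 * Real.sin (2 * Real.pi / (60 : ℕ))) (by rw [← sinPoly]; omega) 1
    have := (mul_eq_zero.mp two_mul_sin_quintic_sixty).resolve_left
      (by simpa [sub_eq_zero] using hne)
    simp
    linear_combination this
  · rw [← sinPoly, hd]
    symm
    compute_degree!

/-! ### Automorphisms for n = 24 and n = 60. -/

theorem le_formAut_of_diag_swap_rotation {P : Polynomial ℚ}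
    (hP : P = Polynomial.X ^ 4 + Polynomial.C 0 * Polynomial.X ^ 3 +
      Polynomial.C (-4) * Polynomial.X ^ 2 + Polynomial.C 0 * Polynomial.X + Polynomial.C 1) :
    glMatrices (glSpan {!![0, 1; 1, 0], !![0, 1; -1, 0]}) ≤
      formAut (P.homogenize P.natDegree) := by
  apply glMatrices_glSpan_le (fun M N => formAut_of_mul_eq_one)
  rintro M (rfl | rfl)
  all_goals
    show formSubst _ _ = _
    apply form_ext
    intro x y
    rw [aeval_formSubst, aeval_homogenize_quartic hP, aeval_homogenize_quartic hP]
    simp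
    ring

theorem formAbsAut_sinForm_twenty_four_le :
    formAbsAut (sinForm 24) ≤ glMatrices (glSpan {!![0, 1; 1, 0], !![0, 1; -1, 0]}) := by
  set G := glMatrices (glSpan {!![0, 1; 1, 0], !![0, 1; -1, 0]}) with hG
  have hle : G ≤ formAbsAut (sinForm 24) :=
    (le_formAut_of_diag_swap_rotation sinPoly_twenty_four).trans (formAut_le_formAbsAut _)
  have hP := sinPoly_twenty_four
  rw [sinPoly] at hP
  rw [sinForm, sinPoly] at hle ⊢
  set α := 2 * Real.sin (2 * Real.pi / (24 : ℕ))
  have hd : (minpoly ℚ α).natDegree = 4 := by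
    rw [hP]
    compute_degree!
  have hα := two_mul_sin_quartic_twenty_four
  change α ^ 4 - 4 * α ^ 2 + 1 = 0 at hα
  have hS : (!![0, 1; 1, 0] : Matrix (Fin 2) (Fin 2) ℚ) ∈ G :=
    mem_glMatrices_glSpan (Or.inl rfl) (by simp)
  have hJ : (!![0, 1; -1, 0] : Matrix (Fin 2) (Fin 2) ℚ) ∈ G :=
    mem_glMatrices_glSpan (Or.inr rfl) (by simp)
  have hD : (!![-1, 0; 0, 1] : Matrix (Fin 2) (Fin 2) ℚ) ∈ G := by
    have := mul_mem hS hJ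
    simpa using this
  have hneg : (-1 : Matrix (Fin 2) (Fin 2) ℚ) ∈ G := by
    have := mul_mem hJ hJ
    rw [neg_one_eq_fin_two]
    simpa using this
  intro M hM
  suffices h : ∃ g ∈ G, M = g ∨ M = -g by
    obtain ⟨g, hg, rfl | rfl⟩ := h
    · exact hg
    · rw [← neg_one_mul]
      exact mul_mem hneg hg
  obtain ⟨-, β, hβ, h₁⟩ := moebius_root_of_mem_formAbsAut (by omega) hM
  rw [hP] at hβ
  simp at hβ
  -- The roots are ±α and ±1/α, and all four are Möbius images of α under the group.
  have hprod : (β - α) * (β + α) * ((α * β - 1) * (α * β + 1)) = 0 := by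
    linear_combination α ^ 2 * hβ - β ^ 2 * hα
  rcases mul_eq_zero.mp hprod with h12 | h34
  · rcases mul_eq_zero.mp h12 with h1 | h2
    · refine ⟨1, one_mem _, eq_or_eq_neg_of_moebius_eq (by omega) hM (one_mem _)
        (one_mul 1) h₁ ?_⟩
      simp
      linarith
    · refine ⟨_, hD, eq_or_eq_neg_of_moebius_eq (by omega) hM (hle hD)
        (h := !![-1, 0; 0, 1]) (by rw [Matrix.one_fin_two]; norm_num) h₁ ?_⟩
      simp
      linarith
  · rcases mul_eq_zero.mp h34 with h3 | h4
    · refine ⟨_, hS, eq_or_eq_neg_of_moebius_eq (by omega) hM (hle hS)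
        (h := !![0, 1; 1, 0]) (by rw [Matrix.one_fin_two]; norm_num) h₁ ?_⟩
      simp
      linarith
    · refine ⟨_, hJ, eq_or_eq_neg_of_moebius_eq (by omega) hM (hle hJ)
        (h := !![0, -1; 1, 0]) (by rw [Matrix.one_fin_two]; norm_num) h₁ ?_⟩
      simp
      linarith

theorem glMatrices_le_formAut_sinForm_sixty :
    glMatrices (glSpan {!![1, 2; -1, -1]}) ≤ formAut (sinForm 60) := by
  apply glMatrices_glSpan_le (fun M N => formAut_of_mul_eq_one)
  rintro M rfl
  show formSubst _ _ = _
  apply form_ext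
  intro x y
  rw [aeval_formSubst, sinForm, aeval_homogenize_quartic sinPoly_sixty,
    aeval_homogenize_quartic sinPoly_sixty]
  simp
  ring

theorem formAbsAut_sinForm_sixty_le :
    formAbsAut (sinForm 60) ≤ glMatrices (glSpan {!![1, 2; -1, -1]}) := by
  set G := glMatrices (glSpan {!![1, 2; -1, -1]}) with hG
  have hle : G ≤ formAbsAut (sinForm 60) :=
    glMatrices_le_formAut_sinForm_sixty.trans (formAut_le_formAbsAut _)
  have hP := sinPoly_sixty
  rw [sinPoly] at hP
  rw [sinForm, sinPoly] at hle ⊢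
  set α := 2 * Real.sin (2 * Real.pi / (60 : ℕ))
  have hd : (minpoly ℚ α).natDegree = 4 := by
    rw [hP]
    compute_degree!
  have hα : α ^ 4 + α ^ 3 - 4 * α ^ 2 - 4 * α + 1 = 0 := by
    have := minpoly.aeval ℚ α
    rw [hP] at this
    simp at this
    linear_combination this
  have hg : (!![1, 2; -1, -1] : Matrix (Fin 2) (Fin 2) ℚ) ∈ G :=
    mem_glMatrices_glSpan rfl (by norm_num)
  have hneg : (-1 : Matrix (Fin 2) (Fin 2) ℚ) ∈ G := by
    have := mul_mem hg hg
    convert this using 1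
    rw [neg_one_eq_fin_two]
    norm_num
  intro M hM
  suffices h : ∃ g ∈ G, M = g ∨ M = -g by
    obtain ⟨g, hg, rfl | rfl⟩ := h
    · exact hg
    · rw [← neg_one_mul]
      exact mul_mem hneg hg
  obtain ⟨hv, β, hβ, h₁⟩ := moebius_root_of_mem_formAbsAut (by omega) hM
  rw [hP] at hβ
  simp at hβ
  -- The four roots as polynomials in α. The second equals -(α + 2)/(α + 1), the image of α under
  -- the generator.
  have hprod : (β - α) * (β - (α ^ 3 - 4 * α - 1)) *
      ((β - (2 - α ^ 2)) * (β - (-α ^ 3 + α ^ 2 + 3 * α - 2))) = 0 := by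
    linear_combination hβ + (-1 + 6 * α ^ 2 - 3 * α ^ 3 - 2 * α ^ 4 + α ^ 5 +
      β * (-6 * α + α ^ 2 + 3 * α ^ 3 - α ^ 4) + β ^ 2 * (2 * α - α ^ 2)) * hα
  rcases mul_eq_zero.mp hprod with h12 | h34
  · rcases mul_eq_zero.mp h12 with h1 | h2
    · refine ⟨1, one_mem _, eq_or_eq_neg_of_moebius_eq (by omega) hM (one_mem _)
        (one_mul 1) h₁ ?_⟩
      simp
      linarith
    · refine ⟨_, hg, eq_or_eq_neg_of_moebius_eq (by omega) hM (hle hg)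
        (h := !![-1, -2; 1, 1]) (by rw [Matrix.one_fin_two]; norm_num) h₁ ?_⟩
      simp
      linear_combination (α + 1) * h2 + hα
  -- The other two roots are not Möbius images of α: clearing the denominator, and reducing by the
  -- quartic in the last case, gives a cubic relation for α. Its vanishing coefficients force t = v
  -- = 0.
  · exfalso
    rcases mul_eq_zero.mp h34 with h3 | h4
    · obtain ⟨-, -, e2, e3⟩ := coeff_eq_zero_of_three_lt_natDegree (α := α) (by omega)
        (a := M 0 1 - 2 * M 1 1) (b := M 0 0 - 2 * M 1 0) (c := M 1 1) (d := M 1 0)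
        (by push_cast; linear_combination h₁ + (M 1 0 * α + M 1 1) * h3)
      exact hv (by simp [e2, e3])
    · obtain ⟨-, -, e2, e3⟩ := coeff_eq_zero_of_three_lt_natDegree (α := α) (by omega)
        (a := M 0 1 + 2 * M 1 1 - M 1 0) (b := M 0 0 + 6 * M 1 0 - 3 * M 1 1)
        (c := M 1 0 - M 1 1) (d := M 1 1 - 2 * M 1 0)
        (by push_cast; linear_combination h₁ + (M 1 0 * α + M 1 1) * h4 - M 1 0 * hα)
      have ht : M 1 0 = 0 := by linarith
      have hv' : M 1 1 = 0 := by linarith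
      exact hv (by simp [ht, hv'])

/-! ### The classification. -/

theorem corollary1p2 (n : ℕ) (hpos : 0 < n)
    (hn : n ∉ ({1, 2, 3, 4, 6, 8, 12, 20} : Finset ℕ)) :
    -- the degree
    ((sinPoly n).natDegree = sinDegree n ∧ 3 ≤ sinDegree n) ∧
    -- part 1
    (n % 8 = 4 → 5 ≤ sinDegree n → Odd (sinDegree n) →
      (formAut (sinForm n) : Set (Matrix (Fin 2) (Fin 2) ℚ)) = {1} ∧
      Nonempty (formAut (sinForm n) ≃* groupC1) ∧
      (formAbsAut (sinForm n) : Set (Matrix (Fin 2) (Fin 2) ℚ)) = {1, -1} ∧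
      Nonempty (formAbsAut (sinForm n) ≃* groupC2)) ∧
    -- part 2
    (n % 8 = 4 → 6 ≤ sinDegree n → Even (sinDegree n) →
      (formAut (sinForm n) : Set (Matrix (Fin 2) (Fin 2) ℚ)) = {1, -1} ∧
      (formAbsAut (sinForm n) : Set (Matrix (Fin 2) (Fin 2) ℚ)) = {1, -1} ∧
      Nonempty (formAut (sinForm n) ≃* groupC2)) ∧
    -- part 3
    (n % 8 ≠ 4 → n ≠ 24 →
      formAut (sinForm n) = glMatrices (glSpan {!![-1, 0; 0, 1], !![1, 0; 0, -1]}) ∧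
      Nonempty (formAut (sinForm n) ≃* groupD2)) ∧
    -- part 4
    ((n = 28 ∨ n = 36) →
      formAut (sinForm n) = glMatrices (glSpan {!![-1, 1; -1, 0]}) ∧
      IsGLConj (formAut (sinForm n)) groupC3 ∧
      formAbsAut (sinForm n) = glMatrices (glSpan {!![-1, 1; -1, 0], !![-1, 0; 0, -1]}) ∧
      IsGLConj (formAbsAut (sinForm n)) groupC6) ∧
    (n = 60 →
      formAut (sinForm n) = glMatrices (glSpan {!![1, 2; -1, -1]}) ∧
      formAbsAut (sinForm n) = glMatrices (glSpan {!![1, 2; -1, -1]}) ∧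
      IsGLConj (formAut (sinForm n)) groupC4 ∧
      IsGLConj (formAbsAut (sinForm n)) groupC4) ∧
    (n = 24 →
      formAut (sinForm n) = glMatrices (glSpan {!![0, 1; 1, 0], !![0, 1; -1, 0]}) ∧
      formAbsAut (sinForm n) = glMatrices (glSpan {!![0, 1; 1, 0], !![0, 1; -1, 0]}) ∧
      IsGLConj (formAut (sinForm n)) groupD4 ∧
      IsGLConj (formAbsAut (sinForm n)) groupD4) := by
  have hdeg := natDegree_sinPoly hpos hn
  have hd3 := three_le_sinDegree hpos hn
  have h4 : 4 < n := by
    simp only [Finset.mem_insert, Finset.mem_singleton] at hn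
    omega
  have hd0 : (sinPoly n).natDegree ≠ 0 := by omega
  have hmon : (sinPoly n).Monic := minpoly.monic (isIntegral_of_natDegree_minpoly_ne_zero hd0)
  refine ⟨⟨hdeg, hd3⟩, ?_, ?_, ?_, ?_, ?_, ?_⟩
  · intro h hd hodd
    have hs : ∀ M ∈ formAbsAut (sinForm n), M 1 0 = 0 ∧ M 0 1 = 0 ∧ M 0 0 = M 1 1 :=
      fun M => scalar_of_mem_formAbsAut_sinForm h h4 hd
    have h1 := formAut_eq_of_scalar_of_odd hmon (hdeg ▸ hodd) hs
    have h2 := formAbsAut_eq_of_scalar hmon hd0 hs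
    exact ⟨h1, nonempty_mulEquiv_of_coe_eq (h1.trans glMatrices_groupC1.symm), h2,
      nonempty_mulEquiv_of_coe_eq (h2.trans glMatrices_groupC2.symm)⟩
  · intro h hd heven
    have hs : ∀ M ∈ formAbsAut (sinForm n), M 1 0 = 0 ∧ M 0 1 = 0 ∧ M 0 0 = M 1 1 :=
      fun M => scalar_of_mem_formAbsAut_sinForm h h4 (by omega)
    have h1 := formAut_eq_of_scalar_of_even hmon hd0 (hdeg ▸ heven) hs
    exact ⟨h1, formAbsAut_eq_of_scalar hmon hd0 hs,
      nonempty_mulEquiv_of_coe_eq (h1.trans glMatrices_groupC2.symm)⟩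
  · intro h h24
    have h1 := formAut_sinForm_eq_diag hpos hn h h24
    exact ⟨h1, nonempty_mulEquiv_of_isGLConj (h1 ▸ isGLConj_diag_groupD2)⟩
  · intro h
    have key : formAut (sinForm n) = glMatrices (glSpan {!![-1, 1; -1, 0]}) ∧
        formAbsAut (sinForm n) =
          glMatrices (glSpan {!![-1, 1; -1, 0], !![-1, 0; 0, -1]}) := by
      rcases h with rfl | rfl
      · exact formAut_simplest_cubic sinPoly_twenty_eight
      · exact formAut_simplest_cubic sinPoly_thirty_six
    obtain ⟨h1, h2⟩ := key
    exact ⟨h1, h1 ▸ isGLConj_groupC3, h2, h2 ▸ isGLConj_groupC6⟩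
  · rintro rfl
    have h1 := le_antisymm ((formAut_le_formAbsAut _).trans formAbsAut_sinForm_sixty_le)
      glMatrices_le_formAut_sinForm_sixty
    have h2 := le_antisymm formAbsAut_sinForm_sixty_le
      (glMatrices_le_formAut_sinForm_sixty.trans (formAut_le_formAbsAut _))
    exact ⟨h1, h2, h1 ▸ isGLConj_groupC4, h2 ▸ isGLConj_groupC4⟩
  · rintro rfl
    have h0 := le_formAut_of_diag_swap_rotation sinPoly_twenty_four
    have h1 := le_antisymm ((formAut_le_formAbsAut _).trans formAbsAut_sinForm_twenty_four_le) h0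
    have h2 := le_antisymm formAbsAut_sinForm_twenty_four_le
      (h0.trans (formAut_le_formAbsAut _))
    exact ⟨h1, h2, h1 ▸ isGLConj_groupD4, h2 ▸ isGLConj_groupD4⟩
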